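/- **Setting.** For $S\ge 1$ let $\mathcal M_S$ be the set of probability vectors of length $S$ and $L_1(P,Q)=\sum_{i=1}^S|p_i-q_i|$. Let $Q\in\mathcal M_S$ be known and $P\in\mathcal M_S$ unknown, and let $n>1$. One observes independent counts $X_{i,1},X_{i,2}\sim\mathsf{Poi}(np_i)$, $1\le i\le S$; put $\hat p_{i,j}=X_{i,j}/n$. We write $a\wedge b=\min\{a,b\}$ and $a\vee b=\max\{a,b\}$, and $\ln$ is the natural logarithm. **Estimator.** For constants $c_1,c_2,c_3>0$ with $c_3<c_1$ and $c_2<c_1$, let $$U(q)=\begin{cases}[0,\tfrac{2c_1\ln n}{n}], & q\le \tfrac{c_1\ln n}{n},\\ \big[q-\sqrt{\tfrac{c_1q\ln n}{n}},\,q+\sqrt{\tfrac{c_1q\ln n}{n}}\big], & q>\tfrac{c_1\ln n}{n},\end{cases}\qquad U_1(q)=\begin{cases}[0,\tfrac{(c_1+c_3)\ln n}{n}], & q\le \tfrac{c_1\ln n}{n},\\ \big[q-\sqrt{\tfrac{c_3q\ln n}{n}},\,q+\sqrt{\tfrac{c_3q\ln n}{n}}\big], & q>\tfrac{c_1\ln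 n}{n}.\end{cases}$$ Let $K=\lfloor c_2\ln n\rfloor$, and let $P_K(x;q)=\sum_{j\le K}a_jx^j$ be the best uniform approximation of $x\mapsto|x-q|$ on $U(q)$ by polynomials of degree at most $K$. Let $\tilde P_K(\hat p;q)=\sum_{j\le K}a_j\prod_{k=0}^{j-1}(\hat p-\tfrac kn)$ be the unbiased estimate of $P_K(p;q)$ from $n\hat p\sim\mathsf{Poi}(np)$. Writing $x>A$ (resp. $x<A$) for "$x>y$ (resp. $x<y$) for all $y\in A$", put $$\tilde L_1=\sum_{i=1}^S\Big[(\hat p_{i,2}-q_i)\mathbf 1(\hat p_{i,1}>U_1(q_i))+(q_i-\hat p_{i,2})\mathbf 1(\hat p_{i,1}<U_1(q_i))+\tilde P_K(\hat p_{i,2};q_i)\mathbf 1(\hat p_{i,1}\in U_1(q_i))\Big]$$ and $\hat L^{(1)}=0\vee(\tilde L_1\wedge 2)$. **Theorem.** 1. For all $\epsilon>0$ and $\beta>0$ there are constants $c_1,c_2,c_3$ as above and $C>0$, depending only on $\epsilon$ and $\beta$, such that for all $n>1$, $S\ge1$ and $Q\in\mathcal M_S$, $$\sup_{P\in\mathcal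 M_S}\mathbb E_P\big|\hat L^{(1)}-L_1(P,Q)\big|^2\le C\left(\Big(\sum_{i=1}^S q_i\wedge\sqrt{\tfrac{q_i}{n\ln n}}\Big)^2+\frac{\ln n}{n^{1-\epsilon}}+\frac{S}{n^\beta}\right).$$ 2. For all $a,b>0$ there are constants $c_1,c_2,c_3$ as above and $C>0$, depending only on $a$ and $b$, such that for all $n>1$, $S\ge1$ and $Q\in\mathcal M_S$ with $\ln S\le a\ln n$ and $\ln n\le b\ln\big(\sum_{i=1}^S\sqrt{q_i}\wedge q_i\sqrt{n\ln n}\big)$, $$\sup_{P\in\mathcal M_S}\mathbb E_P\big|\hat L^{(1)}-L_1(P,Q)\big|^2\le C\Big(\sum_{i=1}^S q_i\wedge\sqrt{\tfrac{q_i}{n\ln n}}\Big)^2.$$ 3. For every $b>0$ there are constants $c_1,c_2,c_3$ as above and $C>0$, depending only on $b$, such that for all $n>1$ and $S\ge1$ with $\ln n\le b\ln S$, $$\sup_{P,Q\in\mathcal M_S}\mathbb E_P\big|\hat L^{(1)}-L_1(P,Q)\big|^2\le C\,\frac{S}{n\ln n}.$$ -/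

import Mathlib

namespace L1Known

open MeasureTheory ProbabilityTheory

noncomputable section

/-- The `L₁` distance between two vectors indexed by `Fin S`. -/
def L1 {S : ℕ} (P Q : Fin S → ℝ) : ℝ := ∑ i, |P i - Q i|

/-! ### Uncertainty sets -/

/-- The uncertainty set `U(q; c₁)`. -/
def U (c₁ n q : ℝ) : Set ℝ :=
  if q ≤ c₁ * Real.log n / n then Set.Icc 0 (2 * c₁ * Real.log n / n)
  else Set.Icc (q - √(c₁ * q * Real.log n / n)) (q + √(c₁ * q * Real.log n / n))

/-- The (smaller) classification set `U₁(q)`. -/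
def U₁ (c₁ c₃ n q : ℝ) : Set ℝ :=
  if q ≤ c₁ * Real.log n / n then Set.Icc 0 ((c₁ + c₃) * Real.log n / n)
  else Set.Icc (q - √(c₃ * q * Real.log n / n)) (q + √(c₃ * q * Real.log n / n))

lemma isCompact_U (c₁ n q : ℝ) : IsCompact (U c₁ n q) := by
  unfold U; split_ifs <;> exact isCompact_Icc

/-! ### Best polynomial approximation -/

/-- The uniform distance on `s` between `f` and the polynomial `P`. -/
def supDist (f : ℝ → ℝ) (s : Set ℝ) (P : Polynomial ℝ) : ℝ := ⨆ z : s, |f z - P.eval (z : ℝ)|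

/-- `P` is a best uniform approximation of `f` on `s` among the polynomials of degree at most
`K`. -/
def IsBestApprox (f : ℝ → ℝ) (s : Set ℝ) (K : ℕ) (P : Polynomial ℝ) : Prop :=
  P.natDegree ≤ K ∧ ∀ R : Polynomial ℝ, R.natDegree ≤ K → supDist f s P ≤ supDist f s R

theorem exists_isBestApprox {f : ℝ → ℝ} {s : Set ℝ} (hf : ContinuousOn f s) (hs : IsCompact s)
    (K : ℕ) : ∃ P, IsBestApprox f s K P := by
  have : CompactSpace s := isCompact_iff_compactSpace.mp hs
  let F : C(s, ℝ) := ⟨fun z => f z, hf.domRestrict⟩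
  let T : Polynomial ℝ →ₗ[ℝ] C(s, ℝ) := (Polynomial.toContinuousMapOnAlgHom s).toLinearMap
  let V : Submodule ℝ C(s, ℝ) := (Polynomial.degreeLT ℝ (K + 1)).map T
  have : FiniteDimensional ℝ (Polynomial.degreeLT ℝ (K + 1)) :=
    Module.Finite.equiv (Polynomial.degreeLTEquiv ℝ (K + 1)).symm
  have : FiniteDimensional ℝ V := by infer_instance
  have : ProperSpace V := FiniteDimensional.proper_real V
  have hd : ∀ P : Polynomial ℝ, supDist f s P = ‖F - T P‖ := by
    intro P
    rw [ContinuousMap.norm_eq_iSup_norm]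
    rfl
  have hmem : ∀ P : Polynomial ℝ, P.natDegree ≤ K ↔ P ∈ Polynomial.degreeLT ℝ (K + 1) := by
    intro P
    rw [Polynomial.mem_degreeLT, Polynomial.degree_lt_iff_coeff_zero,
      Polynomial.natDegree_le_iff_coeff_eq_zero]
    exact Iff.rfl
  obtain ⟨v, hv⟩ : ∃ v : V, ∀ w : V, ‖F - (v : C(s, ℝ))‖ ≤ ‖F - (w : C(s, ℝ))‖ := by
    refine Continuous.exists_forall_le' (f := fun w : V => ‖F - (w : C(s, ℝ))‖) (by fun_prop) 0 ?_
    have h1 : ∀ᶠ w : V in Filter.cocompact V, 2 * ‖F‖ ≤ ‖w‖ :=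
      (tendsto_norm_cocompact_atTop (E := V)).eventually_ge_atTop _
    filter_upwards [h1] with w hw
    have h2 : ‖(w : C(s, ℝ))‖ ≤ ‖F‖ + ‖F - (w : C(s, ℝ))‖ := by
      simpa using norm_sub_le F (F - (w : C(s, ℝ)))
    have h3 : ‖w‖ = ‖(w : C(s, ℝ))‖ := rfl
    simp only [ZeroMemClass.coe_zero, sub_zero]
    linarith
  obtain ⟨P, hP, hPv⟩ := v.2
  refine ⟨P, (hmem P).2 hP, fun R hR => ?_⟩
  rw [hd, hd, hPv]
  exact hv ⟨T R, Submodule.mem_map_of_mem ((hmem R).1 hR)⟩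

open Classical in
/-- The best uniform approximation of `f` on `s` of degree at most `K`; it exists for continuous
`f` and compact `s` by `exists_isBestApprox`. -/
def bestApprox (f : ℝ → ℝ) (s : Set ℝ) (K : ℕ) : Polynomial ℝ :=
  if h : ∃ P, IsBestApprox f s K P then h.choose else 0

theorem isBestApprox_bestApprox {f : ℝ → ℝ} {s : Set ℝ} (hf : ContinuousOn f s)
    (hs : IsCompact s) (K : ℕ) : IsBestApprox f s K (bestApprox f s K) := by
  have h := exists_isBestApprox hf hs K
  rw [bestApprox, dif_pos h]
  exact h.choose_spec

/-- The degree `K = c₂ ln n`, rounded down. -/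
def deg (c₂ n : ℝ) : ℕ := ⌊c₂ * Real.log n⌋₊

/-- `P_K(x; q)`, the best approximation of `x ↦ |x - q|` on `U(q; c₁)` of degree `K = c₂ ln n`. -/
def approxPoly (c₁ c₂ n q : ℝ) : Polynomial ℝ :=
  bestApprox (fun x => |x - q|) (U c₁ n q) (deg c₂ n)

theorem isBestApprox_approxPoly (c₁ c₂ n q : ℝ) :
    IsBestApprox (fun x => |x - q|) (U c₁ n q) (deg c₂ n) (approxPoly c₁ c₂ n q) :=
  isBestApprox_bestApprox (by fun_prop) (isCompact_U c₁ n q) _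

/-! ### The unbiased estimate of a polynomial in the Poisson model -/

/-- The unbiased estimate of `P(p) = ∑ aⱼ pʲ` from `n p̂ ∼ Poi(n p)`, namely
`∑ aⱼ ∏_{k < j} (p̂ - k / n)`; see `unbiased_spec` for the unbiasedness. -/
def unbiased (n : ℝ) (P : Polynomial ℝ) (phat : ℝ) : ℝ :=
  P.sum fun j a => a * ∏ k ∈ Finset.range j, (phat - k / n)

lemma hasSum_descFactorial (r : ℝ) (j : ℕ) :
    HasSum (fun x : ℕ => Real.exp (-r) * r ^ x / x.factorial * (x.descFactorial j : ℝ))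
      (r ^ j) := by
  have hinj : Function.Injective (fun m : ℕ => m + j) := add_left_injective j
  rw [← hinj.hasSum_iff]
  · have h := ((NormedSpace.expSeries_div_hasSum_exp (𝔸 := ℝ) r).mul_left (Real.exp (-r))).mul_right
      (r ^ j)
    rw [← Real.exp_eq_exp_ℝ, ← Real.exp_add, neg_add_cancel, Real.exp_zero, one_mul] at h
    refine Eq.mpr (congrArg (fun g : ℕ → ℝ => HasSum g (r ^ j)) (funext fun m => ?_)) h
    have h1 : ((m + j).factorial : ℝ) = m.factorial * ((m + j).descFactorial j : ℝ) := by
      have := Nat.factorial_mul_descFactorial (Nat.le_add_left j m)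
      rw [Nat.add_sub_cancel] at this
      exact_mod_cast this.symm
    have h2 : ((m + j).descFactorial j : ℝ) ≠ 0 := by
      have := Nat.descFactorial_pos.2 (Nat.le_add_left j m)
      positivity
    have h3 : (m.factorial : ℝ) ≠ 0 := by positivity
    simp only [Function.comp]
    rw [h1]
    field_simp
    ring
  · intro x hx
    have : x < j := by
      by_contra hlt
      exact hx ⟨x - j, by simp only; omega⟩
    simp [Nat.descFactorial_eq_zero_iff_lt.2 this]

theorem unbiased_spec {n p : ℝ} (hn : 0 < n) (hp : 0 ≤ p) (P : Polynomial ℝ) :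
    Integrable (fun x : ℕ => unbiased n P (x / n)) (poissonMeasure (n * p).toNNReal) ∧
      ∫ x : ℕ, unbiased n P (x / n) ∂(poissonMeasure (n * p).toNNReal) = P.eval p := by
  have hr : (((n * p).toNNReal : NNReal) : ℝ) = n * p := Real.coe_toNNReal _ (by positivity)
  have hprod : ∀ j x : ℕ, ∏ k ∈ Finset.range j, ((x : ℝ) / n - k / n)
      = (x.descFactorial j : ℝ) * (n ^ j)⁻¹ := by
    intro j x
    rw [← descPochhammer_eval_eq_descFactorial, descPochhammer_eval_eq_prod_range]
    simp_rw [← sub_div]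
    rw [Finset.prod_div_distrib, Finset.prod_const, Finset.card_range, div_eq_mul_inv]
  have hsum : ∀ j : ℕ, HasSum (fun x : ℕ => Real.exp (-(n * p)) * (n * p) ^ x / x.factorial *
      ∏ k ∈ Finset.range j, ((x : ℝ) / n - k / n)) (p ^ j) := by
    intro j
    have h := (hasSum_descFactorial (n * p) j).mul_right ((n ^ j)⁻¹)
    have h2 : (n * p) ^ j * (n ^ j)⁻¹ = p ^ j := by
      rw [mul_pow]; field_simp
    rw [h2] at h
    simpa only [hprod, mul_assoc] using h
  have hint : ∀ j : ℕ, Integrable (fun x : ℕ => ∏ k ∈ Finset.range j, ((x : ℝ) / n - k / n))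
      (poissonMeasure (n * p).toNNReal) := by
    intro j
    rw [integrable_poissonMeasure_iff, hr]
    refine (hsum j).summable.congr fun x => ?_
    rw [Real.norm_of_nonneg]
    rw [hprod]
    positivity
  have hval : ∀ j : ℕ, ∫ x : ℕ, ∏ k ∈ Finset.range j, ((x : ℝ) / n - k / n)
      ∂(poissonMeasure (n * p).toNNReal) = p ^ j := by
    intro j
    rw [integral_poissonMeasure, hr]
    exact (hsum j).tsum_eq
  simp only [unbiased, Polynomial.sum]
  refine ⟨integrable_finsetSum _ fun j _ => (hint j).const_mul _, ?_⟩
  rw [integral_finsetSum _ fun j _ => (hint j).const_mul _, Polynomial.eval_eq_sum,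
    Polynomial.sum]
  refine Finset.sum_congr rfl fun j _ => ?_
  rw [integral_const_mul, hval]

/-! ### The estimator and its risk -/

open Classical in
/-- The untruncated estimator `L̃₁` computed from the two halves `x`, `y` of the sample (vectors of
counts): the first half classifies the regimes, the second half is used for the estimation. -/
def preEstimator {S : ℕ} (c₁ c₂ c₃ n : ℝ) (Q : Fin S → ℝ) (x y : Fin S → ℕ) : ℝ :=
  ∑ i, ((if ∀ u ∈ U₁ c₁ c₃ n (Q i), u < x i / n then y i / n - Q i else 0)
      + (if ∀ u ∈ U₁ c₁ c₃ n (Q i), x i / n < u then Q i - y i / n else 0)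
      + (if (x i / n : ℝ) ∈ U₁ c₁ c₃ n (Q i) then
          unbiased n (approxPoly c₁ c₂ n (Q i)) (y i / n) else 0))

/-- The estimator `L̂⁽¹⁾ = 0 ∨ (L̃₁ ∧ 2)`. -/
def estimator {S : ℕ} (c₁ c₂ c₃ n : ℝ) (Q : Fin S → ℝ) (x y : Fin S → ℕ) : ℝ :=
  max 0 (min (preEstimator c₁ c₂ c₃ n Q x y) 2)

/-- The law of one half of the sample: independent coordinates `Xᵢ ∼ Poi(n pᵢ)`. -/
def poissonSample {S : ℕ} (n : ℝ) (P : Fin S → ℝ) : Measure (Fin S → ℕ) :=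
  Measure.pi fun i => poissonMeasure (n * P i).toNNReal

instance {S : ℕ} (n : ℝ) (P : Fin S → ℝ) : IsProbabilityMeasure (poissonSample n P) := by
  unfold poissonSample; infer_instance

/-- The mean squared error `E_P |L̂⁽¹⁾ - L₁(P, Q)|²`, the two halves of the sample being
independent. -/
def risk {S : ℕ} (c₁ c₂ c₃ n : ℝ) (Q P : Fin S → ℝ) : ℝ :=
  ∫ z : (Fin S → ℕ) × (Fin S → ℕ), |estimator c₁ c₂ c₃ n Q z.1 z.2 - L1 P Q| ^ 2
    ∂((poissonSample n P).prod (poissonSample n P))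

/-- The expectation defining `risk` is that of a bounded, integrable random variable. -/
lemma integrable_risk {S : ℕ} (c₁ c₂ c₃ n : ℝ) (Q P : Fin S → ℝ) :
    Integrable (fun z : (Fin S → ℕ) × (Fin S → ℕ) =>
      |estimator c₁ c₂ c₃ n Q z.1 z.2 - L1 P Q| ^ 2)
      ((poissonSample n P).prod (poissonSample n P)) := by
  refine Integrable.of_bound (C := (2 + |L1 P Q|) ^ 2)
    (Measurable.of_discrete).aestronglyMeasurable (Filter.Eventually.of_forall fun z => ?_)
  rw [norm_pow, Real.norm_eq_abs, abs_abs]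
  have h0 : 0 ≤ estimator c₁ c₂ c₃ n Q z.1 z.2 := le_max_left _ _
  have h2 : estimator c₁ c₂ c₃ n Q z.1 z.2 ≤ 2 := max_le (by norm_num) (min_le_right _ _)
  gcongr
  calc |estimator c₁ c₂ c₃ n Q z.1 z.2 - L1 P Q|
      ≤ |estimator c₁ c₂ c₃ n Q z.1 z.2| + |L1 P Q| := abs_sub _ _
    _ ≤ 2 + |L1 P Q| := by rw [abs_of_nonneg h0]; linarith

end

end L1Known

/-!
Splitting the Poisson sample in two makes the rule chosen at each symbol, which depends on the first
half, independent of the second half, which is plugged into it. By Chernoff bounds the first half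
classifies all symbols correctly except with probability `O(S / n ^ β)`: outside `U₁` the sign of
`pᵢ - qᵢ` is known, so that the linear estimate is unbiased, and inside `U₁` the probability `pᵢ`
lies in `U`, where the polynomial approximation is valid.

The bias is then the approximation error, which by a Jackson-type bound on `U` is of order
`qᵢ ∧ √(qᵢ / (n ln n))`. For the variance, if `X ∼ Poi(np)` then the unbiased estimate of `P(p)` has
variance `∑_{i ≥ 1} i! (p / n)^i aᵢ²`, where the `aᵢ` are the Taylor coefficients of `P` at `p`.
Chebyshev's extremal inequality bounds `aᵢ` by the supremum of `|P|` on `U`, so the variance at each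
symbol is at most `64 K (p / n) 32^K`, which sums to `n ^ (-1 + ε) ln n` for small `c₂`.

In the regimes of parts 2 and 3 the remaining two terms of part 1 are dominated by the main one, or
by its Cauchy–Schwarz bound `S / (n ln n)`.
-/

namespace L1Known

open Finset MeasureTheory Polynomial ProbabilityTheory
open scoped NNReal

/-! ### Jackson's theorem -/

/-- The squared modulus of the trigonometric polynomial `∑ αₖ e^{ikv}`, `k < m`: the nonnegative
kernel from which the approximating polynomial of Jackson's theorem is built. -/
noncomputable def trigSq (α : ℕ → ℝ) (m : ℕ) (v : ℝ) : ℝ :=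
  Complex.normSq (∑ k ∈ range m, α k * Complex.exp (v * Complex.I) ^ k)

lemma trigSq_nonneg (α : ℕ → ℝ) (m : ℕ) (v : ℝ) : 0 ≤ trigSq α m v :=
  Complex.normSq_nonneg _

lemma trigSq_eq_sum_cos (α : ℕ → ℝ) (m : ℕ) (v : ℝ) :
    trigSq α m v
      = ∑ j ∈ range m, ∑ k ∈ range m, α j * α k * Real.cos (((j : ℤ) - k : ℤ) * v) := by
  have hpow (k : ℕ) : Complex.exp (v * Complex.I) ^ k
      = Real.cos (k * v) + Real.sin (k * v) * Complex.I := by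
    rw [← Complex.exp_nat_mul, ← mul_assoc, Complex.exp_mul_I]
    push_cast
    rfl
  simp only [trigSq, hpow, Complex.normSq_apply, Complex.re_sum, Complex.im_sum,
    Complex.re_ofReal_mul, Complex.im_ofReal_mul, Complex.add_re, Complex.add_im,
    Complex.ofReal_re, Complex.ofReal_im, Complex.I_re, Complex.I_im, mul_zero, mul_one, add_zero,
    zero_add, sum_mul_sum, ← sum_add_distrib]
  refine sum_congr rfl fun j _ => sum_congr rfl fun k _ => ?_
  push_cast
  rw [sub_mul, Real.cos_sub]
  ring

lemma normSq_one_sub_exp_mul_I (v : ℝ) :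
    Complex.normSq (1 - Complex.exp (v * Complex.I)) = 2 - 2 * Real.cos v := by
  rw [Complex.normSq_apply, Complex.exp_mul_I, ← Complex.ofReal_cos, ← Complex.ofReal_sin]
  simp only [Complex.sub_re, Complex.sub_im, Complex.one_re, Complex.one_im, Complex.add_re,
    Complex.add_im, Complex.re_ofReal_mul, Complex.im_ofReal_mul, Complex.ofReal_re,
    Complex.ofReal_im, Complex.I_re, Complex.I_im]
  linear_combination Real.sin_sq_add_cos_sq v

lemma trigSq_forwardDiff {α : ℕ → ℝ} {m : ℕ} (h0 : α 0 = 0) (hm : α m = 0) (v : ℝ) :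
    trigSq (fun k => α (k + 1) - α k) m v = (2 - 2 * Real.cos v) * trigSq α m v := by
  set z := Complex.exp (v * Complex.I) with hz
  have hz1 : Complex.normSq z = 1 := by
    rw [Complex.normSq_eq_norm_sq, hz, Complex.norm_exp_ofReal_mul_I, one_pow]
  have hshift : ∑ k ∈ range m, (α (k + 1) : ℂ) * z ^ (k + 1)
      = ∑ k ∈ range m, (α k : ℂ) * z ^ k := by
    have := sum_range_succ' (fun k => (α k : ℂ) * z ^ k) m
    rw [sum_range_succ, h0, hm] at this
    simpa using this.symm
  have hparts : z * ∑ k ∈ range m, ((α (k + 1) - α k : ℝ) : ℂ) * z ^ k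
      = (1 - z) * ∑ k ∈ range m, (α k : ℂ) * z ^ k := by
    rw [sub_mul, one_mul]
    nth_rewrite 1 [← hshift]
    rw [mul_sum, mul_sum, ← sum_sub_distrib]
    refine sum_congr rfl fun k _ => ?_
    push_cast
    ring
  have hnorm := congrArg Complex.normSq hparts
  rw [map_mul, map_mul, hz1, one_mul, hz, normSq_one_sub_exp_mul_I] at hnorm
  exact hnorm

lemma sum_cos_equidistributed {N : ℕ} (d : ℤ) (hd : ¬ (N : ℤ) ∣ d) (θ : ℝ) :
    ∑ l ∈ range N, Real.cos (d * (θ + 2 * Real.pi * l / N)) = 0 := by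
  rcases Nat.eq_zero_or_pos N with rfl | hN
  · simp
  set ζ := Complex.exp (2 * Real.pi * Complex.I / N)
  have hζ : IsPrimitiveRoot ζ N := Complex.isPrimitiveRoot_exp N hN.ne'
  have hne : ζ ^ d ≠ 1 := fun h => hd ((hζ.zpow_eq_one_iff_dvd d).1 h)
  have hpow : (ζ ^ d) ^ N = 1 := by
    rw [← zpow_natCast, ← zpow_mul, mul_comm, zpow_mul, zpow_natCast, hζ.pow_eq_one, one_zpow]
  have hcos (l : ℕ) : Real.cos (d * (θ + 2 * Real.pi * l / N))
      = (Complex.exp (d * θ * Complex.I) * (ζ ^ d) ^ l).re := by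
    rw [← Complex.exp_int_mul, ← Complex.exp_nat_mul, ← Complex.exp_add,
      show (d * θ * Complex.I + l * (d * (2 * Real.pi * Complex.I / N)) : ℂ)
        = ((d * (θ + 2 * Real.pi * l / N) : ℝ) : ℂ) * Complex.I by push_cast; ring,
      Complex.exp_ofReal_mul_I_re]
  simp_rw [hcos]
  rw [← Complex.re_sum, ← mul_sum, geom_sum_eq hne, hpow, sub_self, zero_div, mul_zero,
    Complex.zero_re]

lemma sum_trigSq_add (α : ℕ → ℝ) {m N : ℕ} (hmN : m ≤ N) (θ : ℝ) :
    ∑ l ∈ range N, trigSq α m (θ + 2 * Real.pi * l / N) = N * ∑ k ∈ range m, α k ^ 2 := by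
  simp only [trigSq_eq_sum_cos]
  rw [sum_comm, mul_sum]
  refine sum_congr rfl fun j hj => ?_
  rw [sum_comm, sum_eq_single_of_mem j hj fun k hk hkj => ?_]
  · simp only [sub_self, Int.cast_zero, zero_mul, Real.cos_zero, sum_const, card_range,
      nsmul_eq_mul]
    ring
  · rw [mem_range] at hj hk
    have hdvd : ¬ (N : ℤ) ∣ (j : ℤ) - k := fun hdvd => by
      have := Int.eq_zero_of_abs_lt_dvd hdvd (by rw [abs_lt]; omega)
      omega
    rw [← mul_sum, sum_cos_equidistributed _ hdvd, mul_zero]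

/-- The kernel `trigSq α m` averaged over the translates by `u` and `-u`, which makes it an even
function of `θ`, hence a polynomial in `cos θ`. -/
noncomputable def evenKernel (α : ℕ → ℝ) (m : ℕ) (u θ : ℝ) : ℝ :=
  (trigSq α m (θ + u) + trigSq α m (-θ + u)) / 2

lemma evenKernel_nonneg (α : ℕ → ℝ) (m : ℕ) (u θ : ℝ) : 0 ≤ evenKernel α m u θ :=
  div_nonneg (add_nonneg (trigSq_nonneg _ _ _) (trigSq_nonneg _ _ _)) zero_le_two

lemma sum_evenKernel (α : ℕ → ℝ) {m N : ℕ} (hmN : m ≤ N) (θ : ℝ) :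
    ∑ l ∈ range N, evenKernel α m (2 * Real.pi * l / N) θ = N * ∑ k ∈ range m, α k ^ 2 := by
  simp only [evenKernel]
  rw [← sum_div, sum_add_distrib, sum_trigSq_add _ hmN, sum_trigSq_add _ hmN, add_self_div_two]

lemma evenKernel_mul_sq_le {α : ℕ → ℝ} {m : ℕ} (h0 : α 0 = 0) (hm : α m = 0) (u θ : ℝ) :
    evenKernel α m u θ * (Real.cos θ - Real.cos u) ^ 2
      ≤ evenKernel (fun k => α (k + 1) - α k) m u θ := by
  have hcos (φ : ℝ) : (Real.cos φ - Real.cos u) ^ 2 ≤ 2 - 2 * Real.cos (φ + u) := by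
    rw [Real.cos_add]
    nlinarith [sq_nonneg (Real.sin φ + Real.sin u), Real.sin_sq_add_cos_sq φ,
      Real.sin_sq_add_cos_sq u]
  have hadd := mul_le_mul_of_nonneg_right (hcos θ) (trigSq_nonneg α m (θ + u))
  have hsub := mul_le_mul_of_nonneg_right (hcos (-θ)) (trigSq_nonneg α m (-θ + u))
  rw [Real.cos_neg] at hsub
  simp only [evenKernel, trigSq_forwardDiff h0 hm]
  linarith

lemma exists_eval_cos_eq_evenKernel {α : ℕ → ℝ} (h0 : α 0 = 0) (m : ℕ) (u : ℝ) :
    ∃ R : ℝ[X], R.natDegree ≤ m ∧ ∀ θ, R.eval (Real.cos θ) = evenKernel α (m + 2) u θ := by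
  refine ⟨∑ j ∈ range (m + 2), ∑ k ∈ range (m + 2),
    C (α j * α k * Real.cos (((j : ℤ) - k : ℤ) * u)) * Chebyshev.T ℝ ((j : ℤ) - k), ?_, fun θ => ?_⟩
  · refine natDegree_sum_le_of_forall_le _ _ fun j hj => natDegree_sum_le_of_forall_le _ _
      fun k hk => ?_
    rcases Nat.eq_zero_or_pos j with rfl | hj0
    · simp [h0]
    rcases Nat.eq_zero_or_pos k with rfl | hk0
    · simp [h0]
    refine (natDegree_C_mul_le _ _).trans ?_
    rw [mem_range] at hj hk
    rw [Chebyshev.natDegree_T]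
    omega
  · simp only [evenKernel, trigSq_eq_sum_cos, eval_finsetSum, eval_mul, eval_C,
      Chebyshev.T_real_cos, ← sum_add_distrib, sum_div]
    refine sum_congr rfl fun j _ => sum_congr rfl fun k _ => ?_
    rw [mul_add, mul_add, Real.cos_add, Real.cos_add, mul_neg, Real.cos_neg, Real.sin_neg]
    ring

/-- Jensen's inequality for the square bounds the mean distance by the root mean square one. -/
lemma abs_sub_sum_mul_le_of_lipschitzOnWith {ι : Type*} {s : Finset ι} {w x : ι → ℝ}
    (hw : ∀ i ∈ s, 0 ≤ w i) (hw1 : ∑ i ∈ s, w i = 1) {f : ℝ → ℝ} {Λ : ℝ≥0} {t : Set ℝ}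
    (hf : LipschitzOnWith Λ f t) {y : ℝ} (hy : y ∈ t) (hx : ∀ i ∈ s, x i ∈ t) :
    |f y - ∑ i ∈ s, w i * f (x i)| ≤ Λ * √(∑ i ∈ s, w i * (y - x i) ^ 2) := by
  have hmean : ∑ i ∈ s, w i * |y - x i| ≤ √(∑ i ∈ s, w i * (y - x i) ^ 2) := by
    refine Real.le_sqrt_of_sq_le ?_
    simpa only [sq_abs] using
      Real.pow_arith_mean_le_arith_mean_pow s w (fun i => |y - x i|) hw hw1
        (fun i _ => abs_nonneg _) 2
  calc |f y - ∑ i ∈ s, w i * f (x i)|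
      = |∑ i ∈ s, w i * (f y - f (x i))| := by
        simp only [mul_sub, sum_sub_distrib, ← sum_mul, hw1, one_mul]
    _ ≤ ∑ i ∈ s, w i * (Λ * |y - x i|) := by
        refine (abs_sum_le_sum_abs _ _).trans (sum_le_sum fun i hi => ?_)
        rw [abs_mul, abs_of_nonneg (hw i hi)]
        exact mul_le_mul_of_nonneg_left (hf.dist_le_mul y hy _ (hx i hi)) (hw i hi)
    _ = Λ * ∑ i ∈ s, w i * |y - x i| := by
        rw [mul_sum]
        exact sum_congr rfl fun i _ => by ring
    _ ≤ _ := mul_le_mul_of_nonneg_left hmean Λ.2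

lemma exists_polynomial_near_of_kernel {α : ℕ → ℝ} {m : ℕ} (h0 : α 0 = 0) (hm : α (m + 2) = 0)
    (hα : 0 < ∑ k ∈ range (m + 2), α k ^ 2) {f : ℝ → ℝ} {Λ : ℝ≥0}
    (hf : LipschitzOnWith Λ f (Set.Icc (-1) 1)) :
    ∃ R : ℝ[X], R.natDegree ≤ m ∧ ∀ t ∈ Set.Icc (-1 : ℝ) 1, |f t - R.eval t|
      ≤ Λ * √((∑ k ∈ range (m + 2), (α (k + 1) - α k) ^ 2) / ∑ k ∈ range (m + 2), α k ^ 2) := by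
  choose R hdeg hR using exists_eval_cos_eq_evenKernel h0 m
  set A := ∑ k ∈ range (m + 2), α k ^ 2
  set c : ℝ := (m + 2 : ℕ) * A with hc
  have hc0 : 0 < c := by positivity
  set u : ℕ → ℝ := fun l => 2 * Real.pi * l / (m + 2 : ℕ)
  refine ⟨∑ l ∈ range (m + 2), C (f (Real.cos (u l)) / c) * R (u l),
    natDegree_sum_le_of_forall_le _ _ fun l _ => (natDegree_C_mul_le _ _).trans (hdeg _),
    fun t ht => ?_⟩
  obtain ⟨θ, rfl⟩ : ∃ θ, t = Real.cos θ := ⟨Real.arccos t, (Real.cos_arccos ht.1 ht.2).symm⟩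
  set w : ℕ → ℝ := fun l => evenKernel α (m + 2) (u l) θ / c
  have hw1 : ∑ l ∈ range (m + 2), w l = 1 := by
    rw [← sum_div, sum_evenKernel _ le_rfl, div_self hc0.ne']
  have heval : (∑ l ∈ range (m + 2), C (f (Real.cos (u l)) / c) * R (u l)).eval (Real.cos θ)
      = ∑ l ∈ range (m + 2), w l * f (Real.cos (u l)) := by
    simp only [eval_finsetSum, eval_mul, eval_C, hR, w]
    exact sum_congr rfl fun l _ => by ring
  rw [heval]
  refine (abs_sub_sum_mul_le_of_lipschitzOnWith
    (fun l _ => div_nonneg (evenKernel_nonneg _ _ _ _) hc0.le) hw1 hf ht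
    fun l _ => Real.cos_mem_Icc _).trans ?_
  gcongr
  calc ∑ l ∈ range (m + 2), w l * (Real.cos θ - Real.cos (u l)) ^ 2
      ≤ ∑ l ∈ range (m + 2), evenKernel (fun k => α (k + 1) - α k) (m + 2) (u l) θ / c := by
        refine sum_le_sum fun l _ => ?_
        rw [div_mul_eq_mul_div]
        gcongr
        exact evenKernel_mul_sq_le h0 hm _ _
    _ = _ := by
        rw [← sum_div, sum_evenKernel _ le_rfl, hc, mul_div_mul_left _ _ (by positivity)]

lemma sum_range_mul_sub_sq (M : ℝ) (n : ℕ) :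
    ∑ k ∈ range n, ((k : ℝ) * (M - k)) ^ 2
      = M ^ 2 * (n * (n - 1) * (2 * n - 1) / 6) - 2 * M * (n * (n - 1) / 2) ^ 2
        + n * (n - 1) * (2 * n - 1) * (3 * n ^ 2 - 3 * n - 1) / 30 := by
  induction n with
  | zero => simp
  | succ k ih => rw [sum_range_succ, ih]; push_cast; ring

lemma sum_range_sub_two_mul_sq (M : ℝ) (n : ℕ) :
    ∑ k ∈ range n, (M - 2 * k) ^ 2
      = n * M ^ 2 - 2 * M * (n * (n - 1)) + 2 * (n * (n - 1) * (2 * n - 1)) / 3 := by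
  induction n with
  | zero => simp
  | succ k ih => rw [sum_range_succ, ih]; push_cast; ring

theorem exists_polynomial_near_of_lipschitzOnWith {f : ℝ → ℝ} {Λ : ℝ≥0}
    (hf : LipschitzOnWith Λ f (Set.Icc (-1) 1)) (m : ℕ) :
    ∃ R : ℝ[X], R.natDegree ≤ m ∧
      ∀ t ∈ Set.Icc (-1 : ℝ) 1, |f t - R.eval t| ≤ Λ * (4 / (m + 2)) := by
  set N : ℝ := m + 2 with hN
  have hN2 : 2 ≤ N := by rw [hN]; linarith [Nat.cast_nonneg (α := ℝ) m]
  have hN4 : 16 ≤ N ^ 4 := by nlinarith [pow_le_pow_left₀ zero_le_two hN2 4]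
  -- A polynomial stand-in for `sin (π k / N)`, which minimises the ratio of the two sums.
  set α : ℕ → ℝ := fun k => k * (N - k) with hα
  have hA : ∑ k ∈ range (m + 2), α k ^ 2 = N * (N ^ 4 - 1) / 30 := by
    rw [sum_range_mul_sub_sq, hN]
    push_cast
    ring
  have hB : ∑ k ∈ range (m + 2), (α (k + 1) - α k) ^ 2 = N * (N ^ 2 - 1) / 3 := by
    have hstep (k : ℕ) : α (k + 1) - α k = (N - 1) - 2 * k := by
      simp only [hα]
      push_cast
      ring
    simp only [hstep, sum_range_sub_two_mul_sq]
    rw [hN]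
    push_cast
    ring
  have hA0 : 0 < N * (N ^ 4 - 1) / 30 := by
    have : 0 < N ^ 4 - 1 := by linarith
    positivity
  obtain ⟨R, hR, hfR⟩ := exists_polynomial_near_of_kernel (α := α) (m := m) (by simp [hα])
    (by simp [hα, hN]) (hA ▸ hA0) hf
  refine ⟨R, hR, fun t ht => (hfR t ht).trans ?_⟩
  rw [hA, hB]
  gcongr
  rw [Real.sqrt_le_left (by positivity), div_le_iff₀ hA0, div_pow]
  have hfactor : (4 : ℝ) ^ 2 / N ^ 2 * (N * (N ^ 4 - 1) / 30)
      = N * (N ^ 2 - 1) / 3 * (16 / 10 * (1 + 1 / N ^ 2)) := by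
    field_simp
    ring
  rw [hfactor]
  refine le_mul_of_one_le_right ?_ ?_
  · have : 1 ≤ N ^ 2 := by nlinarith
    have : 0 ≤ N ^ 2 - 1 := by linarith
    positivity
  · have : 0 ≤ 1 / N ^ 2 := by positivity
    linarith

/-! ### Taylor coefficients of bounded polynomials -/

lemma natDegree_comp_le_of_natDegree_le_one {R : Type*} [Semiring R] {n : ℕ} {P A : R[X]}
    (hP : P.natDegree ≤ n) (hA : A.natDegree ≤ 1) : (P.comp A).natDegree ≤ n :=
  natDegree_comp_le.trans ((Nat.mul_le_mul hP hA).trans_eq (mul_one n))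

lemma eval_two_chebyshev_T_le (n : ℕ) : (Chebyshev.T ℝ n).eval 2 ≤ 4 ^ n := by
  induction n with
  | zero => simp
  | succ k ih =>
    have hge := Chebyshev.one_le_eval_T_real (k - 1 : ℤ) (one_le_two : (1 : ℝ) ≤ 2)
    have hrec := congrArg (eval 2) (Chebyshev.T_add_one ℝ (k : ℤ))
    simp only [eval_sub, eval_mul, eval_X, eval_ofNat] at hrec
    push_cast
    rw [hrec, pow_succ]
    linarith

lemma eval_iterate_derivative_eq_taylor_coeff {R : Type*} [CommSemiring R] (P : R[X]) (r : R)
    (i : ℕ) : (derivative^[i] P).eval r = i.factorial * (taylor r P).coeff i := by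
  rw [taylor_coeff, ← factorial_smul_hasseDeriv, LinearMap.smul_apply, eval_smul, nsmul_eq_mul]

lemma taylor_one_coeff_le_chebyshev_T {n : ℕ} {P : ℝ[X]} (hdeg : P.natDegree ≤ n)
    (hP : ∀ x ∈ Set.Icc (-1 : ℝ) 1, |P.eval x| ≤ 1) (i : ℕ) :
    (taylor 1 P).coeff i ≤ (taylor 1 (Chebyshev.T ℝ n)).coeff i := by
  have h := Chebyshev.eval_iterate_derivative_le_of_forall_abs_le_one (k := i) (x := 1) le_rfl
    (natDegree_le_iff_degree_le.1 hdeg) hP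
  rw [eval_iterate_derivative_eq_taylor_coeff, eval_iterate_derivative_eq_taylor_coeff] at h
  exact le_of_mul_le_mul_left h (by positivity)

lemma taylor_one_chebyshev_T_coeff_le (n i : ℕ) :
    (taylor 1 (Chebyshev.T ℝ n)).coeff i ≤ 4 ^ n := by
  set T := taylor 1 (Chebyshev.T ℝ n) with hT
  have hnonneg (k : ℕ) : 0 ≤ T.coeff k := by
    simpa using taylor_one_coeff_le_chebyshev_T (n := n) (P := 0) (by simp) (by simp) k
  have heval : ∑ k ∈ range (T.natDegree + 1), T.coeff k = (Chebyshev.T ℝ n).eval 2 := by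
    rw [← one_add_one_eq_two, ← taylor_eval, ← hT, eval_eq_sum_range]
    simp only [one_pow, mul_one]
  refine le_trans ?_ (heval.trans_le (eval_two_chebyshev_T_le n))
  by_cases hi : i ∈ range (T.natDegree + 1)
  · exact single_le_sum (f := T.coeff) (fun k _ => hnonneg k) hi
  · rw [coeff_eq_zero_of_natDegree_lt (by simpa using hi)]
    exact sum_nonneg fun k _ => hnonneg k

lemma abs_taylor_one_coeff_le {n : ℕ} {P : ℝ[X]} {M : ℝ} (hM : 0 < M) (hdeg : P.natDegree ≤ n)
    (hP : ∀ x ∈ Set.Icc (-1 : ℝ) 1, |P.eval x| ≤ M) (i : ℕ) :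
    |(taylor 1 P).coeff i| ≤ M * 4 ^ n := by
  have hscaled (c : ℝ) (hc : |c| = M⁻¹) : c * (taylor 1 P).coeff i ≤ 4 ^ n := by
    have := taylor_one_coeff_le_chebyshev_T (P := C c * P) ((natDegree_C_mul_le _ _).trans hdeg)
      (fun x hx => by
        rw [eval_mul, eval_C, abs_mul, hc, inv_mul_le_iff₀ hM, mul_one]
        exact hP x hx) i
    rw [taylor_mul, taylor_C, coeff_C_mul] at this
    exact this.trans (taylor_one_chebyshev_T_coeff_le n i)
  have hpos := hscaled M⁻¹ (abs_of_pos (inv_pos.2 hM))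
  have hneg := hscaled (-M⁻¹) (by rw [abs_neg, abs_of_pos (inv_pos.2 hM)])
  rw [neg_mul, ← mul_neg] at hneg
  rw [inv_mul_le_iff₀ hM] at hpos hneg
  exact abs_le'.2 ⟨hpos, hneg⟩

theorem abs_taylor_coeff_mul_pow_le {n : ℕ} {P : ℝ[X]} {M p r : ℝ} (hM : 0 < M)
    (hdeg : P.natDegree ≤ n) (hP : ∀ x ∈ Set.uIcc p r, |P.eval x| ≤ M) (i : ℕ) :
    |(taylor p P).coeff i| * (|r - p| / 2) ^ i ≤ M * 4 ^ n := by
  -- The affine substitution maps `[-1, 1]` onto the segment and `1` to its endpoint `p`.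
  set Q : ℝ[X] := P.comp (C p + C ((r - p) / 2) * (1 - X)) with hQ
  have hQdeg : Q.natDegree ≤ n :=
    natDegree_comp_le_of_natDegree_le_one hdeg (by compute_degree)
  have hQM (x : ℝ) (hx : x ∈ Set.Icc (-1 : ℝ) 1) : |Q.eval x| ≤ M := by
    have heval : Q.eval x = P.eval (p + (r - p) / 2 * (1 - x)) := by simp [hQ, eval_comp]
    rw [heval]
    refine hP _ (Set.mem_uIcc.2 ?_)
    rcases le_total p r with h | h
    · exact Or.inl ⟨by nlinarith [hx.2], by nlinarith [hx.1]⟩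
    · exact Or.inr ⟨by nlinarith [hx.1], by nlinarith [hx.2]⟩
  have htaylor : taylor 1 Q = (taylor p P).comp (C (-((r - p) / 2)) * X) := by
    rw [hQ, taylor_apply, taylor_apply, comp_assoc, comp_assoc]
    congr 1
    simp only [add_comp, mul_comp, sub_comp, C_comp, X_comp, one_comp, map_neg, C_1]
    ring
  simpa only [htaylor, comp_C_mul_X_coeff, abs_mul, abs_pow, abs_neg, abs_div, abs_two] using
    abs_taylor_one_coeff_le hM hQdeg hQM i

/-! ### Variance of the unbiased estimate -/

lemma add_descFactorial (m j k : ℕ) :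
    (m + j).descFactorial k
      = ∑ i ∈ range (k + 1), k.choose i * j.descFactorial i * m.descFactorial (k - i) := by
  rw [Nat.descFactorial_eq_factorial_mul_choose, add_comm m j, Nat.add_choose_eq,
    Nat.sum_antidiagonal_eq_sum_range_succ_mk, mul_sum]
  refine sum_congr rfl fun i hi => ?_
  rw [← Nat.choose_mul_factorial_mul_factorial (Nat.lt_succ_iff.1 (mem_range.1 hi)),
    Nat.descFactorial_eq_factorial_mul_choose j, Nat.descFactorial_eq_factorial_mul_choose m]
  ring

lemma descFactorial_mul_descFactorial_eq_sum (x j k : ℕ) :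
    x.descFactorial j * x.descFactorial k
      = ∑ i ∈ range (k + 1),
          j.choose i * k.choose i * i.factorial * x.descFactorial (j + k - i) := by
  rcases lt_or_ge x j with hx | hx
  · rw [Nat.descFactorial_eq_zero_iff_lt.2 hx, zero_mul]
    refine (sum_eq_zero fun i hi => ?_).symm
    rw [mem_range] at hi
    rw [Nat.descFactorial_eq_zero_iff_lt.2 (by omega : x < j + k - i), mul_zero]
  · obtain ⟨m, rfl⟩ := Nat.exists_eq_add_of_le' hx
    rw [add_descFactorial m j k, mul_sum]
    refine sum_congr rfl fun i hi => ?_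
    rw [mem_range] at hi
    rw [← Nat.descFactorial_mul_descFactorial (by omega : j ≤ j + k - i), Nat.add_sub_cancel,
      show j + k - i - j = k - i by omega, Nat.descFactorial_eq_factorial_mul_choose j i]
    ring

lemma hasSum_descFactorial_mul_descFactorial (r : ℝ) {j k K : ℕ} (hk : k ≤ K) :
    HasSum (fun x : ℕ => Real.exp (-r) * r ^ x / x.factorial *
        ((x.descFactorial j : ℝ) * x.descFactorial k))
      (∑ i ∈ range (K + 1), (j.choose i * k.choose i * i.factorial : ℝ) * r ^ (j + k - i)) := by
  have hprod (x : ℕ) : (x.descFactorial j : ℝ) * x.descFactorial k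
      = ∑ i ∈ range (K + 1),
          (j.choose i * k.choose i * i.factorial : ℝ) * x.descFactorial (j + k - i) := by
    rw [← sum_subset (range_subset_range.2 (Nat.succ_le_succ hk)) fun i _ hi => ?_]
    · exact_mod_cast descFactorial_mul_descFactorial_eq_sum x j k
    · rw [mem_range, not_lt] at hi
      rw [Nat.choose_eq_zero_of_lt (by omega : k < i), Nat.cast_zero, mul_zero, zero_mul, zero_mul]
  simp_rw [hprod, mul_sum, mul_left_comm _ (_ * _ : ℝ)]
  exact hasSum_sum fun i _ => (hasSum_descFactorial r (j + k - i)).mul_left _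

lemma unbiased_eq_sum_descFactorial (n : ℝ) {P : ℝ[X]} {K : ℕ} (hP : P.natDegree ≤ K) (x : ℕ) :
    unbiased n P (x / n)
      = ∑ j ∈ range (K + 1), P.coeff j * ((x.descFactorial j : ℝ) * (n ^ j)⁻¹) := by
  rw [unbiased, sum_over_range' _ (by simp) (K + 1) (Nat.lt_succ_of_le hP)]
  refine sum_congr rfl fun j _ => ?_
  rw [← descPochhammer_eval_eq_descFactorial, descPochhammer_eval_eq_prod_range]
  simp_rw [← sub_div]
  rw [prod_div_distrib, prod_const, card_range, div_eq_mul_inv]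

lemma taylor_coeff_eq_sum_range {R : Type*} [CommSemiring R] {P : R[X]} {K : ℕ}
    (hP : P.natDegree ≤ K) (p : R) (i : ℕ) :
    (taylor p P).coeff i = ∑ j ∈ range (K + 1), P.coeff j * (j.choose i * p ^ (j - i)) := by
  rw [taylor_coeff, hasseDeriv_apply, sum_over_range' _ (by simp) (K + 1) (Nat.lt_succ_of_le hP),
    eval_finsetSum]
  refine sum_congr rfl fun j _ => ?_
  rw [eval_monomial]
  ring

lemma choose_mul_choose_mul_pow_eq {n : ℝ} (hn : n ≠ 0) (p : ℝ) (i j k : ℕ) :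
    (p / n) ^ i * ((j.choose i * p ^ (j - i)) * (k.choose i * p ^ (k - i)))
      = (n ^ (j + k))⁻¹ * (j.choose i * k.choose i * (n * p) ^ (j + k - i)) := by
  rcases lt_or_ge j i with hj | hj
  · simp [Nat.choose_eq_zero_of_lt hj]
  rcases lt_or_ge k i with hk | hk
  · simp [Nat.choose_eq_zero_of_lt hk]
  obtain ⟨a, rfl⟩ := Nat.exists_eq_add_of_le hj
  obtain ⟨b, rfl⟩ := Nat.exists_eq_add_of_le hk
  rw [show i + a + (i + b) - i = i + a + b by omega, Nat.add_sub_cancel_left,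
    Nat.add_sub_cancel_left, div_pow, show i + a + (i + b) = i + (i + a + b) by ring, pow_add n i,
    mul_pow]
  field_simp
  ring

lemma sum_pow_mul_taylor_coeff_sq {n : ℝ} (hn : n ≠ 0) (p : ℝ) {P : ℝ[X]} {K : ℕ}
    (hP : P.natDegree ≤ K) :
    ∑ i ∈ range (K + 1), (p / n) ^ i * i.factorial * (taylor p P).coeff i ^ 2
      = ∑ j ∈ range (K + 1), ∑ k ∈ range (K + 1), P.coeff j * P.coeff k * (n ^ (j + k))⁻¹ *
        ∑ i ∈ range (K + 1),
          (j.choose i * k.choose i * i.factorial : ℝ) * (n * p) ^ (j + k - i) := by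
  simp_rw [taylor_coeff_eq_sum_range hP, sq, sum_mul_sum, mul_sum]
  rw [sum_comm]
  refine sum_congr rfl fun j _ => ?_
  rw [sum_comm]
  refine sum_congr rfl fun k _ => sum_congr rfl fun i _ => ?_
  linear_combination
    P.coeff j * P.coeff k * i.factorial * choose_mul_choose_mul_pow_eq hn p i j k

section Variance

variable {n p : ℝ} {P : ℝ[X]} {K : ℕ}

theorem hasSum_unbiased_sq (hn : n ≠ 0) (p : ℝ) (hP : P.natDegree ≤ K) :
    HasSum (fun x : ℕ => Real.exp (-(n * p)) * (n * p) ^ x / x.factorial *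
        unbiased n P (x / n) ^ 2)
      (∑ i ∈ range (K + 1), (p / n) ^ i * i.factorial * (taylor p P).coeff i ^ 2) := by
  have hexpand (x : ℕ) :
      Real.exp (-(n * p)) * (n * p) ^ x / x.factorial * unbiased n P (x / n) ^ 2
      = ∑ j ∈ range (K + 1), ∑ k ∈ range (K + 1), P.coeff j * P.coeff k * (n ^ (j + k))⁻¹ *
        (Real.exp (-(n * p)) * (n * p) ^ x / x.factorial *
        ((x.descFactorial j : ℝ) * x.descFactorial k)) := by
    rw [unbiased_eq_sum_descFactorial n hP, sq, sum_mul_sum]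
    simp only [mul_sum]
    refine sum_congr rfl fun j _ => sum_congr rfl fun k _ => ?_
    rw [pow_add, mul_inv]
    ring
  simp_rw [hexpand, sum_pow_mul_taylor_coeff_sq hn p hP]
  exact hasSum_sum fun j _ => hasSum_sum fun k hk =>
    (hasSum_descFactorial_mul_descFactorial _ (Nat.lt_succ_iff.1 (mem_range.1 hk))).mul_left _

lemma memLp_unbiased (hn : 0 < n) (hp : 0 ≤ p) (P : ℝ[X]) :
    MemLp (fun x : ℕ => unbiased n P (x / n)) 2 (poissonMeasure (n * p).toNNReal) := by
  rw [memLp_two_iff_integrable_sq Measurable.of_discrete.aestronglyMeasurable,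
    integrable_poissonMeasure_iff, Real.coe_toNNReal _ (by positivity)]
  refine (hasSum_unbiased_sq hn.ne' p (P := P) le_rfl).summable.congr fun x => ?_
  rw [Real.norm_of_nonneg (sq_nonneg _)]

theorem variance_unbiased (hn : 0 < n) (hp : 0 ≤ p) (hP : P.natDegree ≤ K) :
    Var[fun x : ℕ => unbiased n P (x / n); poissonMeasure (n * p).toNNReal]
      = ∑ i ∈ range K, (p / n) ^ (i + 1) * (i + 1).factorial * (taylor p P).coeff (i + 1) ^ 2 := by
  rw [variance_eq_sub (memLp_unbiased hn hp P), (unbiased_spec hn hp P).2, integral_poissonMeasure,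
    Real.coe_toNNReal _ (by positivity)]
  have hsq := (hasSum_unbiased_sq hn.ne' p hP).tsum_eq
  rw [sum_range_succ', taylor_coeff_zero] at hsq
  simp only [Pi.pow_apply, smul_eq_mul]
  rw [hsq]
  simp

lemma pow_mul_factorial_mul_taylor_coeff_sq_le {a M r : ℝ} (ha : 0 ≤ a) (hM : 0 < M)
    (hr : r ≠ p) (hP : P.natDegree ≤ K) (hPM : ∀ x ∈ Set.uIcc p r, |P.eval x| ≤ M) {i : ℕ}
    (hi : i ≤ K) :
    a ^ i * i.factorial * (taylor p P).coeff i ^ 2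
      ≤ (4 * K * a / (r - p) ^ 2) ^ i * M ^ 2 * 16 ^ K := by
  have : 0 < |r - p| / 2 := half_pos (abs_pos.2 (sub_ne_zero.2 hr))
  have hfact : (i.factorial : ℝ) ≤ (K : ℝ) ^ i := by
    exact_mod_cast (Nat.factorial_le_pow i).trans (Nat.pow_le_pow_left hi i)
  have hcoeff : |(taylor p P).coeff i| ≤ M * 4 ^ K / (|r - p| / 2) ^ i := by
    rw [le_div_iff₀ (by positivity)]
    exact abs_taylor_coeff_mul_pow_le hM hP hPM i
  calc a ^ i * i.factorial * (taylor p P).coeff i ^ 2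
      ≤ a ^ i * (K : ℝ) ^ i * (M * 4 ^ K / (|r - p| / 2) ^ i) ^ 2 := by
        rw [← sq_abs ((taylor p P).coeff i)]
        gcongr
    _ = (a * K / (|r - p| / 2) ^ 2) ^ i * M ^ 2 * (4 ^ K) ^ 2 := by
        generalize |r - p| / 2 = h
        ring
    _ = (4 * K * a / (r - p) ^ 2) ^ i * M ^ 2 * (4 ^ 2) ^ K := by
        rw [div_pow |r - p|, sq_abs, div_div_eq_mul_div, ← pow_mul, ← pow_mul, mul_comm K 2]
        ring
    _ = _ := by norm_num

theorem variance_unbiased_le_of_uIcc {M r : ℝ} (hn : 0 < n) (hp : 0 ≤ p) (hM : 0 < M) (hr : r ≠ p)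
    (hP : P.natDegree ≤ K) (hPM : ∀ x ∈ Set.uIcc p r, |P.eval x| ≤ M)
    (hK : 4 * K * (p / n) ≤ (r - p) ^ 2) :
    Var[fun x : ℕ => unbiased n P (x / n); poissonMeasure (n * p).toNNReal]
      ≤ 4 * K * (p / n) / (r - p) ^ 2 * M ^ 2 * 32 ^ K := by
  set ρ := 4 * K * (p / n) / (r - p) ^ 2
  have hρ0 : 0 ≤ ρ := by positivity
  have hρ1 : ρ ≤ 1 := div_le_one_of_le₀ hK (sq_nonneg _)
  have hterm (i : ℕ) (hi : i ∈ range K) :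
      (p / n) ^ (i + 1) * (i + 1).factorial * (taylor p P).coeff (i + 1) ^ 2
        ≤ ρ * M ^ 2 * 16 ^ K := by
    refine (pow_mul_factorial_mul_taylor_coeff_sq_le (by positivity) hM hr hP hPM
      (mem_range.1 hi)).trans ?_
    gcongr
    exact pow_le_of_le_one hρ0 hρ1 i.succ_ne_zero
  have hK2 : (K : ℝ) ≤ 2 ^ K := by exact_mod_cast Nat.lt_two_pow_self.le
  calc Var[fun x : ℕ => unbiased n P (x / n); poissonMeasure (n * p).toNNReal]
      ≤ ∑ _i ∈ range K, ρ * M ^ 2 * 16 ^ K := by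
        rw [variance_unbiased hn hp hP]
        exact sum_le_sum hterm
    _ = K * (ρ * M ^ 2 * 16 ^ K) := by rw [sum_const, card_range, nsmul_eq_mul]
    _ ≤ 2 ^ K * (ρ * M ^ 2 * 16 ^ K) := by gcongr
    _ = ρ * M ^ 2 * 32 ^ K := by
        rw [show (32 : ℝ) = 2 * 16 by norm_num, mul_pow]
        ring

lemma exists_mem_Icc_half_sub_le_abs_sub {p l u : ℝ} (hp : p ∈ Set.Icc l u) :
    ∃ r ∈ Set.Icc l u, (u - l) / 2 ≤ |r - p| := by
  have hlu := hp.1.trans hp.2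
  rcases le_total p ((l + u) / 2) with h | h
  · exact ⟨u, Set.right_mem_Icc.2 hlu, (by linarith : (u - l) / 2 ≤ u - p).trans (le_abs_self _)⟩
  · exact ⟨l, Set.left_mem_Icc.2 hlu,
      (by linarith : (u - l) / 2 ≤ -(l - p)).trans (neg_le_abs _)⟩

theorem variance_unbiased_le {M l u : ℝ} (hn : 0 < n) (hp : 0 ≤ p) (hpm : p ∈ Set.Icc l u)
    (hlu : l < u) (hM : 0 < M) (hP : P.natDegree ≤ K) (hPM : ∀ x ∈ Set.Icc l u, |P.eval x| ≤ M)
    (hK : 16 * K * (p / n) ≤ (u - l) ^ 2) :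
    Var[fun x : ℕ => unbiased n P (x / n); poissonMeasure (n * p).toNNReal]
      ≤ 16 * K * (p / n) / (u - l) ^ 2 * M ^ 2 * 32 ^ K := by
  obtain ⟨r, hr, hrp⟩ := exists_mem_Icc_half_sub_le_abs_sub hpm
  have hul : 0 < u - l := sub_pos.2 hlu
  have hrp2 : ((u - l) / 2) ^ 2 ≤ (r - p) ^ 2 := by
    rw [← sq_abs (r - p)]
    gcongr
  have hne : r ≠ p := fun h => by
    rw [h, sub_self, abs_zero] at hrp
    linarith
  refine (variance_unbiased_le_of_uIcc hn hp hM hne hP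
    (fun x hx => hPM x (Set.uIcc_subset_Icc hpm hr hx)) (by linarith)).trans ?_
  calc 4 * K * (p / n) / (r - p) ^ 2 * M ^ 2 * 32 ^ K
      ≤ 4 * K * (p / n) / ((u - l) / 2) ^ 2 * M ^ 2 * 32 ^ K := by gcongr
    _ = _ := by
        rw [div_pow]
        field_simp
        ring

end Variance

/-! ### Poisson tails -/

lemma hasSum_poisson_mul_exp (r s : ℝ) :
    HasSum (fun x : ℕ => Real.exp (-r) * r ^ x / x.factorial * Real.exp (s * x))
      (Real.exp (r * (Real.exp s - 1))) := by
  have h := (NormedSpace.expSeries_div_hasSum_exp (𝔸 := ℝ) (r * Real.exp s)).mul_left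
    (Real.exp (-r))
  rw [← Real.exp_eq_exp_ℝ, ← Real.exp_add] at h
  have hterm (x : ℕ) : Real.exp (-r) * r ^ x / x.factorial * Real.exp (s * x) =
      Real.exp (-r) * ((r * Real.exp s) ^ x / x.factorial) := by
    rw [mul_pow, ← Real.exp_nat_mul, mul_comm s]
    ring
  rw [show r * (Real.exp s - 1) = -r + r * Real.exp s by ring]
  simpa only [hterm] using h

lemma integrable_exp_mul_poissonMeasure (r : ℝ≥0) (s : ℝ) :
    Integrable (fun x : ℕ => Real.exp (s * x)) (poissonMeasure r) := by
  rw [integrable_poissonMeasure_iff]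
  exact (hasSum_poisson_mul_exp r s).summable.congr fun x => by
    rw [Real.norm_of_nonneg (Real.exp_nonneg _)]

lemma mgf_poissonMeasure (r : ℝ≥0) (s : ℝ) :
    mgf (fun x : ℕ => (x : ℝ)) (poissonMeasure r) s = Real.exp (r * (Real.exp s - 1)) := by
  rw [mgf, integral_poissonMeasure]
  exact (hasSum_poisson_mul_exp r s).tsum_eq

lemma one_sub_mul_exp_le {r : ℝ} (hr : 0 ≤ r) : (1 - r) * Real.exp r ≤ 1 - r ^ 2 / 2 := by
  set g : ℝ → ℝ := fun x => 1 - x ^ 2 / 2 - (1 - x) * Real.exp x with hg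
  have hderiv (x : ℝ) : HasDerivAt g (x * (Real.exp x - 1)) x := by
    have hsq := (((hasDerivAt_id x).pow 2).div_const 2).const_sub 1
    have hexp := ((hasDerivAt_id x).const_sub 1).mul (Real.hasDerivAt_exp x)
    exact (hsq.sub hexp).congr_deriv (by simp only [id]; ring)
  have hmono : MonotoneOn g (Set.Ici 0) := by
    refine monotoneOn_of_deriv_nonneg (convex_Ici 0)
      (fun x _ => (hderiv x).continuousAt.continuousWithinAt)
      (fun x _ => (hderiv x).differentiableAt.differentiableWithinAt) fun x hx => ?_
    rw [interior_Ici] at hx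
    rw [(hderiv x).deriv]
    exact mul_nonneg hx.le (sub_nonneg.2 (Real.one_le_exp hx.le))
  have h0r := hmono Set.self_mem_Ici hr hr
  simp only [hg, Real.exp_zero] at h0r
  linarith

lemma exp_neg_le_quadratic {r : ℝ} (hr : 0 ≤ r) : Real.exp (-r) ≤ 1 - r + r ^ 2 / 2 := by
  have hexp := Real.quadratic_le_exp_of_nonneg hr
  have hpos : 0 < 1 - r + r ^ 2 / 2 := by nlinarith [sq_nonneg (r - 1)]
  rw [Real.exp_neg, inv_le_iff_one_le_mul₀ (Real.exp_pos r)]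
  calc (1 : ℝ) ≤ (1 - r + r ^ 2 / 2) * (1 + r + r ^ 2 / 2) := by nlinarith [sq_nonneg (r ^ 2)]
    _ ≤ _ := mul_le_mul_of_nonneg_left hexp hpos.le

theorem poissonMeasure_real_ge_le {r : ℝ≥0} {a b : ℝ} (hra : r ≤ a) (hab : a ≤ b) (hb : 0 < b) :
    (poissonMeasure r).real {x : ℕ | b ≤ x} ≤ Real.exp (-((b - a) ^ 2 / (2 * b))) := by
  obtain ⟨s, hs0, rfl⟩ : ∃ s, 0 ≤ s ∧ a = b * (1 - s) :=
    ⟨(b - a) / b, div_nonneg (sub_nonneg.2 hab) hb.le, by field_simp; ring⟩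
  have hchernoff := measure_ge_le_exp_mul_mgf (X := fun x : ℕ => (x : ℝ)) b hs0
    (integrable_exp_mul_poissonMeasure r s)
  rw [mgf_poissonMeasure, ← Real.exp_add] at hchernoff
  refine hchernoff.trans (Real.exp_le_exp.2 ?_)
  calc -s * b + r * (Real.exp s - 1) ≤ -s * b + b * (1 - s) * (Real.exp s - 1) := by
        gcongr
        exact sub_nonneg.2 (Real.one_le_exp hs0)
    _ = -b + b * ((1 - s) * Real.exp s) := by ring
    _ ≤ -b + b * (1 - s ^ 2 / 2) := by gcongr; exact one_sub_mul_exp_le hs0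
    _ = _ := by field_simp; ring

theorem poissonMeasure_real_le_le {r : ℝ≥0} {a b : ℝ} (hbr : b ≤ r) (hab : a ≤ b) (hb : 0 < b) :
    (poissonMeasure r).real {x : ℕ | x ≤ a} ≤ Real.exp (-((b - a) ^ 2 / (2 * b))) := by
  obtain ⟨s, hs0, rfl⟩ : ∃ s, 0 ≤ s ∧ a = b * (1 - s) :=
    ⟨(b - a) / b, div_nonneg (sub_nonneg.2 hab) hb.le, by field_simp; ring⟩
  have hchernoff := measure_le_le_exp_mul_mgf (X := fun x : ℕ => (x : ℝ)) (b * (1 - s))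
    (neg_nonpos.2 hs0) (integrable_exp_mul_poissonMeasure r (-s))
  rw [mgf_poissonMeasure, ← Real.exp_add] at hchernoff
  refine hchernoff.trans (Real.exp_le_exp.2 ?_)
  have hexp : Real.exp (-s) - 1 ≤ 0 := sub_nonpos.2 (Real.exp_le_one_iff.2 (neg_nonpos.2 hs0))
  calc - -s * (b * (1 - s)) + r * (Real.exp (-s) - 1)
      ≤ - -s * (b * (1 - s)) + b * (Real.exp (-s) - 1) := by
        linarith [mul_le_mul_of_nonpos_right hbr hexp]
    _ ≤ - -s * (b * (1 - s)) + b * (1 - s + s ^ 2 / 2 - 1) := by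
        gcongr
        exact exp_neg_le_quadratic hs0
    _ = _ := by field_simp; ring

section Scaled

variable {c n p a b : ℝ}

lemma exp_neg_sq_div_le_rpow (hn : 0 < n) (hb : 0 < b)
    (hsep : c * Real.log n / n * b ≤ 20 * (b - a) ^ 2) :
    Real.exp (-((n * b - n * a) ^ 2 / (2 * (n * b)))) ≤ n ^ (-(c / 40)) := by
  rw [Real.rpow_def_of_pos hn, Real.exp_le_exp, mul_neg, neg_le_neg_iff,
    le_div_iff₀ (by positivity)]
  calc Real.log n * (c / 40) * (2 * (n * b)) = n ^ 2 / 20 * (c * Real.log n / n * b) := by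
        field_simp
        ring
    _ ≤ n ^ 2 / 20 * (20 * (b - a) ^ 2) := by gcongr
    _ = (n * b - n * a) ^ 2 := by ring

lemma poissonMeasure_real_div_ge_le (hn : 0 < n) (hp : 0 ≤ p) (hpa : p ≤ a) (hab : a ≤ b)
    (hb : 0 < b) (hsep : c * Real.log n / n * b ≤ 20 * (b - a) ^ 2) :
    (poissonMeasure (n * p).toNNReal).real {x : ℕ | b ≤ x / n} ≤ n ^ (-(c / 40)) := by
  simp only [le_div_iff₀' hn]
  refine (poissonMeasure_real_ge_le (a := n * a) ?_ (by gcongr) (by positivity)).trans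
    (exp_neg_sq_div_le_rpow hn hb hsep)
  rw [Real.coe_toNNReal _ (by positivity)]
  gcongr

lemma poissonMeasure_real_div_le_le (hn : 0 < n) (hbp : b ≤ p) (hab : a ≤ b) (hb : 0 < b)
    (hsep : c * Real.log n / n * b ≤ 20 * (b - a) ^ 2) :
    (poissonMeasure (n * p).toNNReal).real {x : ℕ | x / n ≤ a} ≤ n ^ (-(c / 40)) := by
  simp only [div_le_iff₀' hn]
  refine (poissonMeasure_real_le_le (b := n * b) ?_ (by gcongr) (by positivity)).trans
    (exp_neg_sq_div_le_rpow hn hb hsep)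
  exact (by gcongr : n * b ≤ n * p).trans (Real.le_coe_toNNReal _)

end Scaled

/-! ### Polynomial approximation of `|x - q|` -/

lemma natDegree_contract_le {R : Type*} [CommSemiring R] {k K : ℕ} (hk : k ≠ 0) {P : R[X]}
    (hP : P.natDegree ≤ K * k) : (contract k P).natDegree ≤ K := by
  refine natDegree_le_iff_coeff_eq_zero.2 fun i hi => ?_
  rw [coeff_contract hk]
  exact coeff_eq_zero_of_natDegree_lt (hP.trans_lt (Nat.mul_lt_mul_of_pos_right hi hk.bot_lt))

lemma expand_contract_two (P : ℝ[X]) :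
    expand ℝ 2 (contract 2 P) = C (1 / 2) * (P + P.comp (-X)) := by
  ext i
  rw [coeff_expand two_pos, coeff_contract two_ne_zero, coeff_C_mul, coeff_add,
    show (-X : ℝ[X]) = C (-1) * X by simp, comp_C_mul_X_coeff]
  split_ifs with hi
  · rw [Nat.div_mul_cancel hi, (even_iff_two_dvd.2 hi).neg_one_pow]
    ring
  · rw [(Nat.not_even_iff_odd.1 fun h => hi h.two_dvd).neg_one_pow]
    ring

lemma eval_contract_two_sq (P : ℝ[X]) (t : ℝ) :
    (contract 2 P).eval (t ^ 2) = (P.eval t + P.eval (-t)) / 2 := by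
  rw [← expand_eval, expand_contract_two, eval_mul, eval_C, eval_add, eval_comp, eval_neg, eval_X]
  ring

-- Extend `g` evenly to `[-1, 1]`: the even part of a polynomial near the extension is a
-- polynomial in `t ^ 2` of half the degree.
lemma exists_polynomial_sq_near_of_lipschitzOnWith {g : ℝ → ℝ} {Λ : ℝ≥0}
    (hg : LipschitzOnWith Λ g (Set.Icc 0 1)) (K : ℕ) :
    ∃ R : ℝ[X], R.natDegree ≤ K ∧
      ∀ t ∈ Set.Icc (0 : ℝ) 1, |g t - R.eval (t ^ 2)| ≤ Λ * (2 / (K + 1)) := by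
  have heven : LipschitzOnWith Λ (fun t => g |t|) (Set.Icc (-1) 1) := by
    have h := hg.comp (lipschitzWith_one_norm.lipschitzOnWith (s := Set.Icc (-1 : ℝ) 1))
      fun t ht => ⟨abs_nonneg t, abs_le.2 ht⟩
    rwa [mul_one] at h
  obtain ⟨P, hP, hPg⟩ := exists_polynomial_near_of_lipschitzOnWith heven (K * 2)
  refine ⟨contract 2 P, natDegree_contract_le two_ne_zero hP, fun t ht => ?_⟩
  have hpos := hPg t ⟨by linarith [ht.1], ht.2⟩
  have hneg := hPg (-t) ⟨by linarith [ht.2], by linarith [ht.1]⟩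
  simp only [abs_neg, abs_of_nonneg ht.1] at hpos hneg
  calc |g t - (contract 2 P).eval (t ^ 2)|
      = |(g t - P.eval t) + (g t - P.eval (-t))| / 2 := by
        rw [eval_contract_two_sq, ← abs_two, ← abs_div, abs_two]
        ring_nf
    _ ≤ (Λ * (4 / ((K * 2 : ℕ) + 2)) + Λ * (4 / ((K * 2 : ℕ) + 2))) / 2 := by
        gcongr
        exact (abs_add_le _ _).trans (add_le_add hpos hneg)
    _ = Λ * (2 / (K + 1)) := by push_cast; field_simp; ring

lemma lipschitzOnWith_min_sq (a : ℝ≥0) :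
    LipschitzOnWith (2 * a) (fun t : ℝ => min (a : ℝ) t ^ 2) (Set.Icc 0 1) := by
  refine LipschitzOnWith.of_dist_le_mul fun x hx y hy => ?_
  have hdiff : |min (a : ℝ) x - min (a : ℝ) y| ≤ |x - y| := by
    have h := abs_min_sub_min_le_max (a : ℝ) x a y
    rwa [sub_self, abs_zero, max_eq_right (abs_nonneg _)] at h
  rw [Real.dist_eq, Real.dist_eq, sq_sub_sq, abs_mul,
    abs_of_nonneg (add_nonneg (le_min a.coe_nonneg hx.1) (le_min a.coe_nonneg hy.1))]
  push_cast
  gcongr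
  linarith [min_le_left (a : ℝ) x, min_le_left (a : ℝ) y]

lemma exists_polynomial_near_min {L q : ℝ} (hL : 0 < L) (hq : 0 ≤ q) (K : ℕ) :
    ∃ R : ℝ[X], R.natDegree ≤ K ∧
      ∀ x ∈ Set.Icc 0 L, |min q x - R.eval x| ≤ 4 * √(q * L) / (K + 1) := by
  obtain ⟨a, ha⟩ : ∃ a : ℝ≥0, (a : ℝ) = √(q / L) := ⟨⟨_, Real.sqrt_nonneg _⟩, rfl⟩
  have hqa : q = L * a ^ 2 := by
    rw [ha, Real.sq_sqrt (by positivity), mul_div_cancel₀ _ hL.ne']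
  have hsqrt : √(q * L) = L * a := by
    rw [hqa, show L * (a : ℝ) ^ 2 * L = (L * a) ^ 2 by ring, Real.sqrt_sq (by positivity)]
  obtain ⟨R, hR, hRa⟩ := exists_polynomial_sq_near_of_lipschitzOnWith (lipschitzOnWith_min_sq a) K
  refine ⟨C L * R.comp (C L⁻¹ * X), (natDegree_C_mul_le _ _).trans
    (natDegree_comp_le_of_natDegree_le_one hR (by compute_degree)), fun x hx => ?_⟩
  obtain ⟨t, ht, hxt⟩ : ∃ t ∈ Set.Icc (0 : ℝ) 1, x = L * t ^ 2 :=
    ⟨√(x / L), ⟨Real.sqrt_nonneg _, Real.sqrt_le_one.2 ((div_le_one hL).2 hx.2)⟩, by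
      rw [Real.sq_sqrt (div_nonneg hx.1 hL.le), mul_div_cancel₀ _ hL.ne']⟩
  have hmin : min q x = L * min (a : ℝ) t ^ 2 := by
    rw [hqa, hxt, ← mul_min_of_nonneg _ _ hL.le]
    congr 1
    exact ((pow_left_monotoneOn (n := 2)).map_min a.2 ht.1).symm
  have heval : (C L * R.comp (C L⁻¹ * X)).eval x = L * R.eval (t ^ 2) := by
    rw [eval_mul, eval_comp, eval_mul, eval_C, eval_C, eval_X, hxt, inv_mul_cancel_left₀ hL.ne']
  rw [hmin, heval, ← mul_sub, abs_mul, abs_of_pos hL, hsqrt]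
  calc L * |min (a : ℝ) t ^ 2 - R.eval (t ^ 2)| ≤ L * ((2 * a : ℝ≥0) * (2 / (K + 1))) :=
        mul_le_mul_of_nonneg_left (hRa t ht) hL.le
    _ = 4 * (L * a) / (K + 1) := by push_cast; ring

lemma exists_polynomial_near_abs_sub {L q : ℝ} (hL : 0 < L) (hq : 0 ≤ q) {K : ℕ} (hK : 1 ≤ K) :
    ∃ R : ℝ[X], R.natDegree ≤ K ∧
      ∀ x ∈ Set.Icc 0 L, |(|x - q|) - R.eval x| ≤ 8 * √(q * L) / (K + 1) := by
  obtain ⟨R, hR, hRe⟩ := exists_polynomial_near_min hL hq K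
  refine ⟨X + C q - C 2 * R, ?_, fun x hx => ?_⟩
  · refine (natDegree_sub_le _ _).trans (max_le ?_ ((natDegree_C_mul_le _ _).trans hR))
    rw [natDegree_X_add_C]
    exact hK
  · have habs : |x - q| = x + q - 2 * min q x := by
      rcases le_total q x with h | h
      · rw [min_eq_left h, abs_of_nonneg (by linarith)]
        ring
      · rw [min_eq_right h, abs_of_nonpos (by linarith)]
        ring
    have herr : |x - q| - (X + C q - C 2 * R).eval x = -(2 * (min q x - R.eval x)) := by
      simp only [habs, eval_sub, eval_add, eval_mul, eval_X, eval_C]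
      ring
    rw [herr, abs_neg, abs_mul, abs_two]
    calc 2 * |min q x - R.eval x| ≤ 2 * (4 * √(q * L) / (K + 1)) := by gcongr; exact hRe x hx
      _ = 8 * √(q * L) / (K + 1) := by ring

lemma exists_polynomial_near_abs_sub_symm {w : ℝ} (hw : 0 < w) (q : ℝ) (K : ℕ) :
    ∃ R : ℝ[X], R.natDegree ≤ K ∧
      ∀ x ∈ Set.Icc (q - w) (q + w), |(|x - q|) - R.eval x| ≤ 4 * w / (K + 2) := by
  obtain ⟨R, hR, hRe⟩ := exists_polynomial_near_of_lipschitzOnWith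
    (lipschitzWith_one_norm.lipschitzOnWith (s := Set.Icc (-1 : ℝ) 1)) K
  refine ⟨C w * R.comp (C w⁻¹ * (X - C q)), (natDegree_C_mul_le _ _).trans
    (natDegree_comp_le_of_natDegree_le_one hR (by compute_degree)), fun x hx => ?_⟩
  obtain ⟨t, rfl⟩ : ∃ t, x = q + w * t := ⟨(x - q) / w, by field_simp; ring⟩
  have ht : t ∈ Set.Icc (-1 : ℝ) 1 :=
    ⟨by nlinarith [hx.1], le_of_mul_le_mul_left (by linarith [hx.2]) hw⟩
  have heval : (C w * R.comp (C w⁻¹ * (X - C q))).eval (q + w * t) = w * R.eval t := by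
    rw [eval_mul, eval_comp, eval_mul, eval_sub, eval_C, eval_C, eval_C, eval_X,
      add_sub_cancel_left, inv_mul_cancel_left₀ hw.ne']
  rw [heval, add_sub_cancel_left, abs_mul, abs_of_pos hw, ← mul_sub, abs_mul, abs_of_pos hw]
  calc w * |(|t|) - R.eval t| ≤ w * ((1 : ℝ≥0) * (4 / (K + 2))) :=
        mul_le_mul_of_nonneg_left (hRe t ht) hw.le
    _ = 4 * w / (K + 2) := by push_cast; ring

/-! ### Bias and variance of the best approximation -/

section ApproxPoly

variable {c₁ c₂ n q x : ℝ}

lemma U_of_le (h : q ≤ c₁ * Real.log n / n) :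
    U c₁ n q = Set.Icc 0 (2 * (c₁ * Real.log n / n)) := by
  rw [U, if_pos h]
  ring_nf

lemma U_of_lt (h : c₁ * Real.log n / n < q) :
    U c₁ n q = Set.Icc (q - √(q * (c₁ * Real.log n / n))) (q + √(q * (c₁ * Real.log n / n))) := by
  rw [U, if_neg h.not_ge]
  ring_nf

lemma sqrt_mul_le_left {a b : ℝ} (ha : 0 ≤ a) (hba : b ≤ a) : √(a * b) ≤ a :=
  Real.sqrt_le_iff.2 ⟨ha, by nlinarith⟩

lemma nonneg_of_mem_U (hq : 0 ≤ q) (hx : x ∈ U c₁ n q) : 0 ≤ x := by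
  rcases le_or_gt q (c₁ * Real.log n / n) with h | h
  · rw [U_of_le h] at hx
    exact hx.1
  · rw [U_of_lt h] at hx
    linarith [hx.1, sqrt_mul_le_left hq h.le]

lemma exists_U_eq_Icc (hlam : 0 < c₁ * Real.log n / n) (hq : 0 ≤ q) :
    ∃ l u, l < u ∧ U c₁ n q = Set.Icc l u ∧ 2 * (c₁ * Real.log n / n) * u ≤ (u - l) ^ 2 ∧
      ∀ x ∈ Set.Icc l u, |x - q| ≤ u - l := by
  set lam := c₁ * Real.log n / n
  rcases le_or_gt q lam with h | h
  · exact ⟨0, 2 * lam, by linarith, U_of_le h, by nlinarith, fun x hx =>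
      abs_le.2 ⟨by linarith [hx.1], by linarith [hx.2]⟩⟩
  · have hw : 0 < √(q * lam) := Real.sqrt_pos.2 (mul_pos (hlam.trans h) hlam)
    have hw2 : √(q * lam) ^ 2 = q * lam := Real.sq_sqrt (mul_nonneg hq hlam.le)
    have hwq : √(q * lam) ≤ q := sqrt_mul_le_left hq h.le
    exact ⟨_, _, by linarith, U_of_lt h, by nlinarith, fun x hx =>
      abs_le.2 ⟨by linarith [hx.1], by linarith [hx.2]⟩⟩

lemma abs_sub_eval_le_supDist {f : ℝ → ℝ} {s : Set ℝ} (hf : ContinuousOn f s) (hs : IsCompact s)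
    (P : ℝ[X]) (hx : x ∈ s) : |f x - P.eval x| ≤ supDist f s P := by
  have hbdd := (hs.image_of_continuousOn (hf.sub P.continuousOn).abs).bddAbove
  rw [Set.image_eq_range] at hbdd
  exact le_ciSup hbdd ⟨x, hx⟩

lemma abs_sub_approxPoly_le {B : ℝ} (hB : 0 ≤ B) {R : ℝ[X]} (hR : R.natDegree ≤ deg c₂ n)
    (h : ∀ x ∈ U c₁ n q, |(|x - q|) - R.eval x| ≤ B) (hx : x ∈ U c₁ n q) :
    |(|x - q|) - (approxPoly c₁ c₂ n q).eval x| ≤ B :=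
  (abs_sub_eval_le_supDist (f := fun x => |x - q|) (by fun_prop) (isCompact_U c₁ n q) _ hx).trans
    (((isBestApprox_approxPoly c₁ c₂ n q).2 R hR).trans (Real.iSup_le (fun z => h z z.2) hB))

lemma abs_sub_approxPoly_le_self (hq : 0 ≤ q) (hK : 1 ≤ deg c₂ n) (hx : x ∈ U c₁ n q) :
    |(|x - q|) - (approxPoly c₁ c₂ n q).eval x| ≤ q := by
  refine abs_sub_approxPoly_le hq (natDegree_X_le.trans hK) (fun z hz => ?_) hx
  have hz0 := nonneg_of_mem_U hq hz
  calc |(|z - q|) - eval z X| = |(|z - q|) - (|z|)| := by rw [eval_X, abs_of_nonneg hz0]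
    _ ≤ |z - q - z| := abs_abs_sub_abs_le_abs_sub _ _
    _ = q := by rw [sub_sub_cancel_left, abs_neg, abs_of_nonneg hq]

lemma abs_sub_approxPoly_le_sqrt (hlam : 0 < c₁ * Real.log n / n) (hq : 0 ≤ q)
    (hK : 1 ≤ deg c₂ n) (hx : x ∈ U c₁ n q) :
    |(|x - q|) - (approxPoly c₁ c₂ n q).eval x|
      ≤ 8 * √(q * (2 * (c₁ * Real.log n / n))) / (deg c₂ n + 1) := by
  rcases le_or_gt q (c₁ * Real.log n / n) with h | h
  · obtain ⟨R, hR, hRe⟩ :=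
      exists_polynomial_near_abs_sub (by positivity : 0 < 2 * (c₁ * Real.log n / n)) hq hK
    exact abs_sub_approxPoly_le (by positivity) hR (by rwa [U_of_le h]) hx
  · obtain ⟨R, hR, hRe⟩ := exists_polynomial_near_abs_sub_symm
      (Real.sqrt_pos.2 (mul_pos (hlam.trans h) hlam)) q (deg c₂ n)
    rw [← U_of_lt h] at hRe
    refine (abs_sub_approxPoly_le (by positivity) hR hRe hx).trans ?_
    gcongr
    · norm_num
    · linarith
    · norm_num

lemma mul_log_lt_deg_add_one (c₂ n : ℝ) : c₂ * Real.log n < deg c₂ n + 1 :=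
  Nat.lt_floor_add_one _

lemma one_le_deg (h : 1 ≤ c₂ * Real.log n) : 1 ≤ deg c₂ n := (Nat.one_le_floor_iff _).2 h

lemma deg_le (h : 0 ≤ c₂ * Real.log n) : (deg c₂ n : ℝ) ≤ c₂ * Real.log n := Nat.floor_le h

lemma sqrt_mul_log_div_eq {c : ℝ} (hc : 0 ≤ c) (hn : 1 < n) (hq : 0 ≤ q) :
    √(q * (c * Real.log n / n)) = √c * Real.log n * √(q / (n * Real.log n)) := by
  have hlog := Real.log_pos hn
  rw [Real.sqrt_eq_iff_eq_sq (by positivity) (by positivity), mul_pow, mul_pow, Real.sq_sqrt hc,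
    Real.sq_sqrt (by positivity)]
  field_simp

theorem abs_sub_approxPoly_le_min (hc₁ : 0 < c₁) (hc₂ : 0 < c₂) (hn : 1 < n)
    (hK : 1 ≤ c₂ * Real.log n) (hq : 0 ≤ q) (hx : x ∈ U c₁ n q) :
    |(|x - q|) - (approxPoly c₁ c₂ n q).eval x|
      ≤ (1 + 8 * √(2 * c₁) / c₂) * min q (√(q / (n * Real.log n))) := by
  have hlog := Real.log_pos hn
  have hcoef : 0 ≤ 8 * √(2 * c₁) / c₂ := by positivity
  rw [mul_min_of_nonneg _ _ (by positivity)]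
  refine le_min ?_ ?_
  · refine (abs_sub_approxPoly_le_self hq (one_le_deg hK) hx).trans ?_
    exact le_mul_of_one_le_left hq (by linarith)
  · refine (abs_sub_approxPoly_le_sqrt (by positivity) hq (one_le_deg hK) hx).trans ?_
    calc 8 * √(q * (2 * (c₁ * Real.log n / n))) / (deg c₂ n + 1)
        ≤ 8 * √(q * (2 * (c₁ * Real.log n / n))) / (c₂ * Real.log n) := by
          gcongr
          exact (mul_log_lt_deg_add_one c₂ n).le
      _ = 8 * √(2 * c₁) / c₂ * √(q / (n * Real.log n)) := by
          rw [show 2 * (c₁ * Real.log n / n) = 2 * c₁ * Real.log n / n by ring,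
            sqrt_mul_log_div_eq (by positivity) hn hq]
          field_simp
      _ ≤ (1 + 8 * √(2 * c₁) / c₂) * √(q / (n * Real.log n)) := by
          gcongr
          linarith

theorem variance_unbiased_approxPoly_le (hc₂ : 0 < c₂) (hc : 8 * c₂ ≤ c₁) (hn : 1 < n) (hq : 0 ≤ q)
    (hx : x ∈ U c₁ n q) :
    Var[fun y : ℕ => unbiased n (approxPoly c₁ c₂ n q) (y / n); poissonMeasure (n * x).toNNReal]
      ≤ 64 * deg c₂ n * (x / n) * 32 ^ deg c₂ n := by
  have hlog := Real.log_pos hn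
  have hn0 : 0 < n := by linarith
  have hlam : 0 < c₁ * Real.log n / n := by
    have : 0 < c₁ := by linarith
    positivity
  have hx0 := nonneg_of_mem_U hq hx
  obtain ⟨l, u, hlu, hU, hwidth, hdist⟩ := exists_U_eq_Icc hlam hq
  have hlu0 : 0 < u - l := sub_pos.2 hlu
  have hbound (z : ℝ) (hz : z ∈ Set.Icc l u) :
      |(approxPoly c₁ c₂ n q).eval z| ≤ 2 * (u - l) := by
    have herr : |(|z - q|) - (approxPoly c₁ c₂ n q).eval z| ≤ u - l :=
      abs_sub_approxPoly_le hlu0.le (R := 0) (by simp) (by simpa [hU] using hdist) (hU ▸ hz)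
    have hz_dist := hdist z hz
    rw [abs_le] at herr ⊢
    constructor <;> linarith [abs_nonneg (z - q)]
  have hdeg : 16 * deg c₂ n * (x / n) ≤ (u - l) ^ 2 := by
    calc 16 * deg c₂ n * (x / n) ≤ 16 * (c₂ * Real.log n) * (x / n) := by
          gcongr
          exact deg_le (by positivity)
      _ = 2 * (8 * c₂ * Real.log n / n) * x := by ring
      _ ≤ 2 * (c₁ * Real.log n / n) * u := by
          gcongr
          exact (hU ▸ hx).2
      _ ≤ (u - l) ^ 2 := hwidth
  calc _ ≤ 16 * deg c₂ n * (x / n) / (u - l) ^ 2 * (2 * (u - l)) ^ 2 * 32 ^ deg c₂ n :=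
        variance_unbiased_le hn0 hx0 (hU ▸ hx) hlu (by positivity)
          (isBestApprox_approxPoly c₁ c₂ n q).1 hbound hdeg
    _ = 64 * deg c₂ n * (x / n) * 32 ^ deg c₂ n := by
        field_simp
        ring

end ApproxPoly

/-! ### Classification of the symbols -/

section Classification

variable {c₁ c₃ n q p t a b : ℝ}

/-- The empirical frequency `t` selects a valid estimation rule for a symbol of probability `p`:
the sign of `p - q` is the one suggested by `t` when `t` lies outside `U₁`, and `p` lies in the
interval `U` on which `|x - q|` is approximated when `t` lies in `U₁`. -/
def WellClassified (c₁ c₃ n q p t : ℝ) : Prop :=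
  ((∀ u ∈ U₁ c₁ c₃ n q, u < t) → q ≤ p) ∧ ((∀ u ∈ U₁ c₁ c₃ n q, t < u) → p ≤ q) ∧
    (t ∈ U₁ c₁ c₃ n q → p ∈ U c₁ n q)

lemma forall_mem_Icc_lt_iff (hab : a ≤ b) : (∀ u ∈ Set.Icc a b, u < t) ↔ b < t :=
  ⟨fun h => h b (Set.right_mem_Icc.2 hab), fun h _ hu => hu.2.trans_lt h⟩

lemma forall_mem_Icc_gt_iff (hab : a ≤ b) : (∀ u ∈ Set.Icc a b, t < u) ↔ t < a :=
  ⟨fun h => h a (Set.left_mem_Icc.2 hab), fun h _ hu => h.trans_le hu.1⟩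

lemma wellClassified_iff_of_U₁_eq_Icc (hab : a ≤ b) (hU₁ : U₁ c₁ c₃ n q = Set.Icc a b) :
    WellClassified c₁ c₃ n q p t ↔
      (b < t → q ≤ p) ∧ (t < a → p ≤ q) ∧ (a ≤ t → t ≤ b → p ∈ U c₁ n q) := by
  rw [WellClassified, hU₁, forall_mem_Icc_lt_iff hab, forall_mem_Icc_gt_iff hab, Set.mem_Icc,
    and_imp]

lemma U₁_quarter_of_le (h : q ≤ c₁ * Real.log n / n) :
    U₁ c₁ (c₁ / 4) n q = Set.Icc 0 (5 / 4 * (c₁ * Real.log n / n)) := by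
  rw [U₁, if_pos h]
  ring_nf

lemma U₁_quarter_of_lt (h : c₁ * Real.log n / n < q) :
    U₁ c₁ (c₁ / 4) n q = Set.Icc (q - √(q * (c₁ * Real.log n / n)) / 2)
      (q + √(q * (c₁ * Real.log n / n)) / 2) := by
  have hsqrt : √(c₁ / 4 * q * Real.log n / n) = √(q * (c₁ * Real.log n / n)) / 2 := by
    rw [show c₁ / 4 * q * Real.log n / n = q * (c₁ * Real.log n / n) / 2 ^ 2 by ring,
      Real.sqrt_div' _ (by positivity), Real.sqrt_sq zero_le_two]
  rw [U₁, if_neg h.not_ge, hsqrt]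

lemma poissonMeasure_real_not_wellClassified_le_of_ge (hn : 0 < n) (hp : 0 ≤ p) (hpa : p ≤ a)
    (hab : a ≤ b) (hb : 0 < b) (hsep : c₁ * Real.log n / n * b ≤ 20 * (b - a) ^ 2)
    (h : ∀ t < b, WellClassified c₁ c₃ n q p t) :
    (poissonMeasure (n * p).toNNReal).real {x : ℕ | ¬ WellClassified c₁ c₃ n q p (x / n)}
      ≤ n ^ (-(c₁ / 40)) :=
  (measureReal_mono fun _ hx => le_of_not_gt (mt (h _) hx)).trans
    (poissonMeasure_real_div_ge_le hn hp hpa hab hb hsep)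

lemma poissonMeasure_real_not_wellClassified_le_of_le (hn : 0 < n) (hbp : b ≤ p)
    (hab : a ≤ b) (hb : 0 < b) (hsep : c₁ * Real.log n / n * b ≤ 20 * (b - a) ^ 2)
    (h : ∀ t > a, WellClassified c₁ c₃ n q p t) :
    (poissonMeasure (n * p).toNNReal).real {x : ℕ | ¬ WellClassified c₁ c₃ n q p (x / n)}
      ≤ n ^ (-(c₁ / 40)) :=
  (measureReal_mono fun _ hx => le_of_not_gt (mt (h _) hx)).trans
    (poissonMeasure_real_div_le_le hn hbp hab hb hsep)

lemma poissonMeasure_real_not_wellClassified_le_of_small (hc₁ : 0 < c₁) (hn : 1 < n) (hp : 0 ≤ p)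
    (h : q ≤ c₁ * Real.log n / n) :
    (poissonMeasure (n * p).toNNReal).real {x : ℕ | ¬ WellClassified c₁ (c₁ / 4) n q p (x / n)}
      ≤ n ^ (-(c₁ / 40)) := by
  have hlog := Real.log_pos hn
  have hn0 : 0 < n := by linarith
  have hlam : 0 < c₁ * Real.log n / n := by positivity
  have hiff (t : ℝ) := wellClassified_iff_of_U₁_eq_Icc (p := p) (t := t) (by positivity)
    (U₁_quarter_of_le h)
  simp only [U_of_le h, Set.mem_Icc] at hiff
  set lam := c₁ * Real.log n / n
  rcases lt_or_ge (2 * lam) p with hp2 | hp2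
  · refine poissonMeasure_real_not_wellClassified_le_of_le (a := 5 / 4 * lam) (b := 2 * lam) hn0
      hp2.le (by linarith) (by linarith) (by nlinarith) fun t ht => (hiff t).2 ?_
    exact ⟨fun _ => by linarith, fun _ => by linarith, fun _ _ => by linarith⟩
  rcases lt_or_ge p q with hpq | hpq
  · refine poissonMeasure_real_not_wellClassified_le_of_ge (a := lam) (b := 5 / 4 * lam) hn0 hp
      (by linarith) (by linarith) (by linarith) (by nlinarith) fun t ht => (hiff t).2 ?_
    exact ⟨fun _ => by linarith, fun _ => hpq.le, fun _ _ => ⟨hp, hp2⟩⟩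
  · have hall (x : ℕ) : WellClassified c₁ (c₁ / 4) n q p (x / n) :=
      have hx : (0 : ℝ) ≤ x / n := by positivity
      (hiff _).2 ⟨fun _ => hpq, fun _ => by linarith, fun _ _ => ⟨hp, hp2⟩⟩
    simp only [hall, not_true_eq_false, Set.ofPred_false, measureReal_empty]
    positivity

lemma poissonMeasure_real_not_wellClassified_le_of_large (hc₁ : 0 < c₁) (hn : 1 < n) (hp : 0 ≤ p)
    (h : c₁ * Real.log n / n < q) :
    (poissonMeasure (n * p).toNNReal).real {x : ℕ | ¬ WellClassified c₁ (c₁ / 4) n q p (x / n)}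
      ≤ n ^ (-(c₁ / 40)) := by
  have hlog := Real.log_pos hn
  have hn0 : 0 < n := by linarith
  have hlam : 0 < c₁ * Real.log n / n := by positivity
  have hiff (t : ℝ) := wellClassified_iff_of_U₁_eq_Icc (p := p) (t := t)
    (by linarith [Real.sqrt_nonneg (q * (c₁ * Real.log n / n))]) (U₁_quarter_of_lt h)
  simp only [U_of_lt h, Set.mem_Icc] at hiff
  set lam := c₁ * Real.log n / n
  have hq : 0 < q := hlam.trans h
  have hw0 : 0 < √(q * lam) := Real.sqrt_pos.2 (mul_pos hq hlam)
  have hw2 : √(q * lam) ^ 2 = q * lam := Real.sq_sqrt (mul_nonneg hq.le hlam.le)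
  have hwq : √(q * lam) ≤ q := sqrt_mul_le_left hq.le h.le
  set w := √(q * lam)
  have hlw : lam * w ≤ w ^ 2 := by nlinarith
  have hlw0 : 0 < lam * w := mul_pos hlam hw0
  rcases lt_or_ge p (q - w) with hp1 | hp1
  · refine poissonMeasure_real_not_wellClassified_le_of_ge (a := q - w) (b := q - w / 2) hn0 hp
      hp1.le (by linarith) (by linarith) (by nlinarith) fun t ht => (hiff t).2 ?_
    exact ⟨fun _ => by linarith, fun _ => by linarith, fun _ _ => by linarith⟩
  rcases lt_or_ge (q + w) p with hp2 | hp2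
  · refine poissonMeasure_real_not_wellClassified_le_of_le (a := q + w / 2) (b := q + w) hn0
      hp2.le (by linarith) (by linarith) (by nlinarith) fun t ht => (hiff t).2 ?_
    exact ⟨fun _ => by linarith, fun _ => by linarith, fun _ _ => by linarith⟩
  rcases le_or_gt p q with hpq | hpq
  · refine poissonMeasure_real_not_wellClassified_le_of_ge (a := q) (b := q + w / 2) hn0 hp
      hpq (by linarith) (by linarith) (by nlinarith) fun t ht => (hiff t).2 ?_
    exact ⟨fun _ => by linarith, fun _ => hpq, fun _ _ => ⟨hp1, hp2⟩⟩
  · refine poissonMeasure_real_not_wellClassified_le_of_le (a := q - w / 2) (b := q) hn0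
      hpq.le (by linarith) hq (by nlinarith) fun t ht => (hiff t).2 ?_
    exact ⟨fun _ => hpq.le, fun _ => by linarith, fun _ _ => ⟨hp1, hp2⟩⟩

theorem poissonMeasure_real_not_wellClassified_le (hc₁ : 0 < c₁) (hn : 1 < n) (hp : 0 ≤ p)
    (q : ℝ) :
    (poissonMeasure (n * p).toNNReal).real {x : ℕ | ¬ WellClassified c₁ (c₁ / 4) n q p (x / n)}
      ≤ n ^ (-(c₁ / 40)) :=
  (le_or_gt q (c₁ * Real.log n / n)).elim
    (poissonMeasure_real_not_wellClassified_le_of_small hc₁ hn hp)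
    (poissonMeasure_real_not_wellClassified_le_of_large hc₁ hn hp)

end Classification

/-! ### The polynomial estimated at a symbol -/

section SelectedPoly

variable {c₁ c₂ c₃ n q p t : ℝ}

lemma unbiased_of_natDegree_le_one (n : ℝ) {P : ℝ[X]} (hP : P.natDegree ≤ 1) (y : ℝ) :
    unbiased n P y = P.eval y := by
  rw [unbiased, sum_over_range' _ (by simp) 2 (Nat.lt_succ_of_le hP),
    eval_eq_sum_range' (Nat.lt_succ_of_le hP)]
  simp [sum_range_succ]

lemma variance_unbiased_of_natDegree_le_one (hn : 0 < n) (hp : 0 ≤ p) {P : ℝ[X]}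
    (hP : P.natDegree ≤ 1) :
    Var[fun y : ℕ => unbiased n P (y / n); poissonMeasure (n * p).toNNReal]
      = p / n * P.derivative.eval p ^ 2 := by
  rw [variance_unbiased hn hp hP, sum_range_one, taylor_coeff_one]
  simp

open Classical in
/-- The polynomial in `p` whose unbiased estimate is the contribution to `preEstimator` of a symbol
whose frequency in the first half of the sample is `t`. -/
noncomputable def selectedPoly (c₁ c₂ c₃ n q t : ℝ) : ℝ[X] :=
  if ∀ u ∈ U₁ c₁ c₃ n q, u < t then X - C q
  else if ∀ u ∈ U₁ c₁ c₃ n q, t < u then C q - X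
  else approxPoly c₁ c₂ n q

lemma exists_U₁_eq_Icc (hc₁ : 0 ≤ c₁) (hc₃ : 0 ≤ c₃) (hn : 1 ≤ n) (q : ℝ) :
    ∃ a b, a ≤ b ∧ U₁ c₁ c₃ n q = Set.Icc a b := by
  have := Real.log_nonneg hn
  unfold U₁
  split_ifs
  · exact ⟨_, _, by positivity, rfl⟩
  · exact ⟨_, _, by linarith [Real.sqrt_nonneg (c₃ * q * Real.log n / n)], rfl⟩

lemma nonempty_U₁ (hc₁ : 0 ≤ c₁) (hc₃ : 0 ≤ c₃) (hn : 1 ≤ n) (q : ℝ) :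
    (U₁ c₁ c₃ n q).Nonempty := by
  obtain ⟨a, b, hab, hU₁⟩ := exists_U₁_eq_Icc hc₁ hc₃ hn q
  exact hU₁ ▸ Set.nonempty_Icc.2 hab

lemma mem_U₁_of_not_forall (hc₁ : 0 ≤ c₁) (hc₃ : 0 ≤ c₃) (hn : 1 ≤ n)
    (hlt : ¬ ∀ u ∈ U₁ c₁ c₃ n q, u < t) (hgt : ¬ ∀ u ∈ U₁ c₁ c₃ n q, t < u) :
    t ∈ U₁ c₁ c₃ n q := by
  obtain ⟨a, b, hab, hU₁⟩ := exists_U₁_eq_Icc hc₁ hc₃ hn q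
  rw [hU₁] at hlt hgt ⊢
  rw [forall_mem_Icc_lt_iff hab, not_lt] at hlt
  rw [forall_mem_Icc_gt_iff hab, not_lt] at hgt
  exact ⟨hgt, hlt⟩

theorem preEstimator_eq_sum_unbiased (hc₁ : 0 ≤ c₁) (hc₃ : 0 ≤ c₃) (hn : 1 ≤ n) {S : ℕ}
    (Q : Fin S → ℝ) (x y : Fin S → ℕ) :
    preEstimator c₁ c₂ c₃ n Q x y
      = ∑ i, unbiased n (selectedPoly c₁ c₂ c₃ n (Q i) (x i / n)) (y i / n) := by
  refine sum_congr rfl fun i _ => ?_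
  obtain ⟨u, hu⟩ := nonempty_U₁ hc₁ hc₃ hn (Q i)
  unfold selectedPoly
  by_cases hlt : ∀ u ∈ U₁ c₁ c₃ n (Q i), u < (x i / n : ℝ)
  · rw [if_pos hlt, if_pos hlt, if_neg fun h => (h u hu).not_gt (hlt u hu),
      if_neg fun h => (hlt _ h).false, unbiased_of_natDegree_le_one n (by compute_degree)]
    simp
  by_cases hgt : ∀ u ∈ U₁ c₁ c₃ n (Q i), (x i / n : ℝ) < u
  · rw [if_neg hlt, if_neg hlt, if_pos hgt, if_pos hgt, if_neg fun h => (hgt _ h).false,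
      unbiased_of_natDegree_le_one n (by compute_degree)]
    simp
  · rw [if_neg hlt, if_neg hlt, if_neg hgt, if_neg hgt,
      if_pos (mem_U₁_of_not_forall hc₁ hc₃ hn hlt hgt), zero_add, zero_add]

theorem abs_eval_selectedPoly_sub_le (hc₁ : 0 < c₁) (hc₂ : 0 < c₂) (hc₃ : 0 ≤ c₃) (hn : 1 < n)
    (hK : 1 ≤ c₂ * Real.log n) (hq : 0 ≤ q) (h : WellClassified c₁ c₃ n q p t) :
    |(selectedPoly c₁ c₂ c₃ n q t).eval p - (|p - q|)|
      ≤ (1 + 8 * √(2 * c₁) / c₂) * min q (√(q / (n * Real.log n))) := by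
  unfold selectedPoly
  split_ifs with hlt hgt
  · rw [eval_sub, eval_X, eval_C, abs_of_nonneg (sub_nonneg.2 (h.1 hlt)), sub_self, abs_zero]
    positivity
  · rw [eval_sub, eval_X, eval_C, abs_of_nonpos (sub_nonpos.2 (h.2.1 hgt)), neg_sub, sub_self,
      abs_zero]
    positivity
  · rw [abs_sub_comm]
    exact abs_sub_approxPoly_le_min hc₁ hc₂ hn hK hq
      (h.2.2 (mem_U₁_of_not_forall hc₁.le hc₃ hn.le hlt hgt))

theorem variance_unbiased_selectedPoly_le (hc₂ : 0 < c₂) (hc : 8 * c₂ ≤ c₁) (hc₃ : 0 ≤ c₃)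
    (hn : 1 < n) (hK : 1 ≤ c₂ * Real.log n) (hq : 0 ≤ q) (hp : 0 ≤ p)
    (h : WellClassified c₁ c₃ n q p t) :
    Var[fun y : ℕ => unbiased n (selectedPoly c₁ c₂ c₃ n q t) (y / n);
        poissonMeasure (n * p).toNNReal]
      ≤ 64 * deg c₂ n * (p / n) * 32 ^ deg c₂ n := by
  have hn0 : 0 < n := by linarith
  have hdeg : (1 : ℝ) ≤ deg c₂ n := by exact_mod_cast one_le_deg hK
  have hlinear : p / n ≤ 64 * deg c₂ n * (p / n) * 32 ^ deg c₂ n :=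
    calc p / n = 1 * 1 * (p / n) * 1 := by ring
      _ ≤ 64 * deg c₂ n * (p / n) * 32 ^ deg c₂ n := by
          gcongr
          · norm_num
          · exact one_le_pow₀ (by norm_num)
  unfold selectedPoly
  split_ifs with hlt hgt
  · rw [variance_unbiased_of_natDegree_le_one hn0 hp (by compute_degree)]
    simpa using hlinear
  · rw [variance_unbiased_of_natDegree_le_one hn0 hp (by compute_degree)]
    simpa using hlinear
  · exact variance_unbiased_approxPoly_le hc₂ hc hn hq
      (h.2.2 (mem_U₁_of_not_forall (by linarith) hc₃ hn.le hlt hgt))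

end SelectedPoly

/-! ### Sums of independent random variables -/

section Independent

lemma integral_sub_sq {Ω : Type*} [MeasurableSpace Ω] {μ : Measure Ω} [IsProbabilityMeasure μ]
    {X : Ω → ℝ} (hX : MemLp X 2 μ) (θ : ℝ) :
    ∫ ω, (X ω - θ) ^ 2 ∂μ = Var[X; μ] + (∫ ω, X ω ∂μ - θ) ^ 2 := by
  have h := variance_eq_sub (hX.sub (memLp_const θ))
  have hmean : ∫ ω, (X ω - θ) ∂μ = ∫ ω, X ω ∂μ - θ := by
    simp [integral_sub (hX.integrable one_le_two) (integrable_const θ)]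
  simp only [Pi.pow_apply, Pi.sub_def] at h
  rw [variance_sub_const hX.aestronglyMeasurable, hmean] at h
  linarith

variable {ι : Type*} [Fintype ι] {Ω : ι → Type*} [∀ i, MeasurableSpace (Ω i)]
  {μ : ∀ i, Measure (Ω i)} [∀ i, IsProbabilityMeasure (μ i)] {X : ∀ i, Ω i → ℝ}

lemma memLp_sum_pi (hX : ∀ i, MemLp (X i) 2 (μ i)) :
    MemLp (fun ω : ∀ i, Ω i => ∑ i, X i (ω i)) 2 (Measure.pi μ) :=
  memLp_finsetSum _ fun i _ => (hX i).comp_measurePreserving (measurePreserving_eval μ i)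

theorem integral_sum_sub_sq (hX : ∀ i, MemLp (X i) 2 (μ i)) (θ : ℝ) :
    ∫ ω, (∑ i, X i (ω i) - θ) ^ 2 ∂Measure.pi μ
      = ∑ i, Var[X i; μ i] + (∑ i, ∫ x, X i x ∂μ i - θ) ^ 2 := by
  have hsum : (∑ i, fun ω : ∀ i, Ω i => X i (ω i)) = fun ω => ∑ i, X i (ω i) := by
    ext ω
    simp
  have hint : ∀ i, Integrable (fun ω : ∀ i, Ω i => X i (ω i)) (Measure.pi μ) := fun i =>
    (measurePreserving_eval μ i).integrable_comp_of_integrable ((hX i).integrable one_le_two)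
  rw [integral_sub_sq (memLp_sum_pi hX), ← variance_sum_pi hX, hsum,
    integral_finsetSum _ fun i _ => hint i]
  congr 4 with i
  exact integral_comp_eval (hX i).aestronglyMeasurable

lemma measureReal_pi_exists_le {s : ∀ i, Set (Ω i)} (hs : ∀ i, MeasurableSet (s i)) :
    (Measure.pi μ).real {ω | ∃ i, ω i ∈ s i} ≤ ∑ i, (μ i).real (s i) := by
  rw [Set.ofPred_exists]
  refine (measureReal_iUnion_fintype_le _).trans_eq (sum_congr rfl fun i _ => ?_)
  exact (measurePreserving_eval μ i).measureReal_preimage (hs i).nullMeasurableSet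

end Independent

/-! ### Reduction to well-classified samples -/

section Risk

lemma abs_clip_sub_le {a b θ : ℝ} (hθ : θ ∈ Set.Icc a b) (t : ℝ) :
    |max a (min t b) - θ| ≤ |t - θ| := by
  calc |max a (min t b) - θ| = |max a (min t b) - max a (min θ b)| := by
        rw [min_eq_left hθ.2, max_eq_right hθ.1]
    _ ≤ |min t b - min θ b| := by
        simpa using abs_max_sub_max_le_max a (min t b) a (min θ b)
    _ ≤ |t - θ| := by
        simpa using abs_min_sub_min_le_max t b θ b

lemma integral_prod_le_of_le {α β : Type*} [MeasurableSpace α] [MeasurableSpace β]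
    {μ : Measure α} {ν : Measure β} [IsProbabilityMeasure μ] [IsProbabilityMeasure ν]
    {f : α × β → ℝ} (hf : Integrable f (μ.prod ν)) (hf₀ : ∀ z, 0 ≤ f z) {M B : ℝ}
    (hfM : ∀ z, f z ≤ M) (hB : 0 ≤ B) {s : Set α} (hs : MeasurableSet s)
    (hfB : ∀ x ∉ s, ∫ y, f (x, y) ∂ν ≤ B) :
    ∫ z, f z ∂μ.prod ν ≤ M * μ.real s + B := by
  have hM : ∀ x, ∫ y, f (x, y) ∂ν ≤ M := fun x => by
    simpa using integral_mono_of_nonneg (.of_forall fun y => hf₀ (x, y)) 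
      (integrable_const M (μ := ν)) (.of_forall fun y => hfM (x, y))
  have hM₀ : Integrable (s.indicator fun _ => M) μ := (integrable_const M).indicator hs
  calc ∫ z, f z ∂μ.prod ν = ∫ x, ∫ y, f (x, y) ∂ν ∂μ := integral_prod f hf
    _ ≤ ∫ x, (s.indicator (fun _ => M) x + B) ∂μ := by
        refine integral_mono hf.integral_prod_left (hM₀.add (integrable_const B)) fun x => ?_
        by_cases hx : x ∈ s
        · simpa only [Set.indicator_of_mem hx] using (hM x).trans (le_add_of_nonneg_right hB)
        · simpa only [Set.indicator_of_notMem hx, zero_add] using hfB x hx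
    _ = M * μ.real s + B := by
        rw [integral_add hM₀ (integrable_const B), integral_indicator_const _ hs]
        simp [mul_comm]

variable {c₁ c₂ c₃ n : ℝ} {S : ℕ} {P Q : Fin S → ℝ}

lemma L1_mem_Icc (hP : P ∈ stdSimplex ℝ (Fin S)) (hQ : Q ∈ stdSimplex ℝ (Fin S)) :
    L1 P Q ∈ Set.Icc 0 2 := by
  refine ⟨sum_nonneg fun i _ => abs_nonneg _, ?_⟩
  calc L1 P Q ≤ ∑ i, (P i + Q i) := sum_le_sum fun i _ =>
        abs_sub_le_of_nonneg_of_le (hP.1 i) (le_add_of_nonneg_right (hQ.1 i)) (hQ.1 i)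
          (le_add_of_nonneg_left (hP.1 i))
    _ = 2 := by rw [sum_add_distrib, hP.2, hQ.2, one_add_one_eq_two]

lemma abs_estimator_sub_L1_sq_le_four (hP : P ∈ stdSimplex ℝ (Fin S))
    (hQ : Q ∈ stdSimplex ℝ (Fin S)) (x y : Fin S → ℕ) :
    |estimator c₁ c₂ c₃ n Q x y - L1 P Q| ^ 2 ≤ 4 := by
  obtain ⟨h₀, h₂⟩ := L1_mem_Icc hP hQ
  calc |estimator c₁ c₂ c₃ n Q x y - L1 P Q| ^ 2 ≤ 2 ^ 2 := by
        gcongr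
        simpa only [sub_zero, estimator] using abs_sub_le_of_le_of_le (le_max_left _ _)
          (max_le zero_le_two (min_le_right _ _)) h₀ h₂
    _ = 4 := by norm_num

lemma risk_le_four (hP : P ∈ stdSimplex ℝ (Fin S)) (hQ : Q ∈ stdSimplex ℝ (Fin S)) :
    risk c₁ c₂ c₃ n Q P ≤ 4 :=
  (integral_mono (integrable_risk c₁ c₂ c₃ n Q P) (integrable_const 4) fun z =>
    abs_estimator_sub_L1_sq_le_four hP hQ z.1 z.2).trans (by simp)

theorem risk_le_of_forall_wellClassified (hP : P ∈ stdSimplex ℝ (Fin S))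
    (hQ : Q ∈ stdSimplex ℝ (Fin S)) {B : ℝ} (hB : 0 ≤ B)
    (hint : ∀ x : Fin S → ℕ, (∀ i, WellClassified c₁ c₃ n (Q i) (P i) (x i / n)) →
      Integrable (fun y => (preEstimator c₁ c₂ c₃ n Q x y - L1 P Q) ^ 2) (poissonSample n P))
    (hle : ∀ x : Fin S → ℕ, (∀ i, WellClassified c₁ c₃ n (Q i) (P i) (x i / n)) →
      ∫ y, (preEstimator c₁ c₂ c₃ n Q x y - L1 P Q) ^ 2 ∂poissonSample n P ≤ B) :
    risk c₁ c₂ c₃ n Q P ≤ 4 * ∑ i, (poissonMeasure (n * P i).toNNReal).real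
      {x : ℕ | ¬ WellClassified c₁ c₃ n (Q i) (P i) (x / n)} + B := by
  refine (integral_prod_le_of_le (integrable_risk c₁ c₂ c₃ n Q P) (fun z => by positivity)
    (fun z => abs_estimator_sub_L1_sq_le_four hP hQ z.1 z.2) hB
    (s := {x | ∃ i, x i ∈ {k : ℕ | ¬ WellClassified c₁ c₃ n (Q i) (P i) (k / n)}})
    .of_discrete fun x hx => ?_).trans ?_
  · have hgood : ∀ i, WellClassified c₁ c₃ n (Q i) (P i) (x i / n) := by simpa using hx
    refine (integral_mono_of_nonneg (.of_forall fun y => by positivity) (hint x hgood)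
      (.of_forall fun y => ?_)).trans (hle x hgood)
    simp only
    rw [← sq_abs (preEstimator c₁ c₂ c₃ n Q x y - L1 P Q)]
    exact pow_le_pow_left₀ (abs_nonneg _) (abs_clip_sub_le (L1_mem_Icc hP hQ) _) 2
  · gcongr
    exact measureReal_pi_exists_le fun _ => .of_discrete

end Risk

/-! ### Risk bounds -/

section RiskBounds

variable {c₁ c₂ c₃ n β : ℝ} {S : ℕ} {P Q : Fin S → ℝ}

lemma pow_deg_le_rpow (hc₂ : 0 ≤ c₂) (hn : 1 ≤ n) : (32 : ℝ) ^ deg c₂ n ≤ n ^ (4 * c₂) := by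
  have hlog := Real.log_nonneg hn
  have h32 : (32 : ℝ) ≤ Real.exp 4 :=
    calc (32 : ℝ) ≤ 2.7 ^ 4 := by norm_num
      _ ≤ Real.exp 1 ^ 4 := by gcongr; linarith [Real.exp_one_gt_d9]
      _ = Real.exp 4 := by rw [← Real.exp_nat_mul]; norm_num
  calc (32 : ℝ) ^ deg c₂ n ≤ Real.exp 4 ^ deg c₂ n := by gcongr
    _ = Real.exp (deg c₂ n * 4) := (Real.exp_nat_mul _ _).symm
    _ ≤ Real.exp (c₂ * Real.log n * 4) := by
        gcongr
        exact deg_le (by positivity)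
    _ = n ^ (4 * c₂) := by
        rw [Real.rpow_def_of_pos (by linarith)]
        ring_nf

lemma integrable_preEstimator_sub_sq (hc₁ : 0 ≤ c₁) (hc₃ : 0 ≤ c₃) (hn : 1 ≤ n)
    (hP : P ∈ stdSimplex ℝ (Fin S)) (Q : Fin S → ℝ) (x : Fin S → ℕ) (θ : ℝ) :
    Integrable (fun y => (preEstimator c₁ c₂ c₃ n Q x y - θ) ^ 2) (poissonSample n P) := by
  simp only [preEstimator_eq_sum_unbiased hc₁ hc₃ hn]
  exact ((memLp_sum_pi fun i => memLp_unbiased (by linarith) (hP.1 i) _).sub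
    (memLp_const θ)).integrable_sq

section WellClassifiedSample

variable {x : Fin S → ℕ}

lemma sum_variance_unbiased_selectedPoly_le (hc₂ : 0 < c₂) (hc : 8 * c₂ ≤ c₁) (hc₃ : 0 ≤ c₃)
    (hn : 1 < n) (hK : 1 ≤ c₂ * Real.log n) (hP : P ∈ stdSimplex ℝ (Fin S))
    (hQ : ∀ i, 0 ≤ Q i) (h : ∀ i, WellClassified c₁ c₃ n (Q i) (P i) (x i / n)) :
    ∑ i, Var[fun y : ℕ => unbiased n (selectedPoly c₁ c₂ c₃ n (Q i) (x i / n)) (y / n);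
        poissonMeasure (n * P i).toNNReal]
      ≤ 64 * c₂ * (Real.log n / n ^ (1 - 4 * c₂)) := by
  have hn0 : 0 < n := by linarith
  calc _ ≤ ∑ i, 64 * deg c₂ n * (P i / n) * 32 ^ deg c₂ n := sum_le_sum fun i _ =>
        variance_unbiased_selectedPoly_le hc₂ hc hc₃ hn hK (hQ i) (hP.1 i) (h i)
    _ = 64 * deg c₂ n / n * 32 ^ deg c₂ n := by
        rw [← sum_mul, ← mul_sum, ← sum_div, hP.2]
        ring
    _ ≤ 64 * (c₂ * Real.log n) / n * n ^ (4 * c₂) := by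
        gcongr
        · exact deg_le (by linarith)
        · exact pow_deg_le_rpow hc₂.le hn.le
    _ = 64 * c₂ * (Real.log n / n ^ (1 - 4 * c₂)) := by
        rw [Real.rpow_sub hn0, Real.rpow_one]
        field_simp

lemma abs_sum_eval_selectedPoly_sub_L1_le (hc₁ : 0 < c₁) (hc₂ : 0 < c₂) (hc₃ : 0 ≤ c₃)
    (hn : 1 < n) (hK : 1 ≤ c₂ * Real.log n) (hQ : ∀ i, 0 ≤ Q i)
    (h : ∀ i, WellClassified c₁ c₃ n (Q i) (P i) (x i / n)) :
    |∑ i, (selectedPoly c₁ c₂ c₃ n (Q i) (x i / n)).eval (P i) - L1 P Q|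
      ≤ (1 + 8 * √(2 * c₁) / c₂) * ∑ i, min (Q i) (√(Q i / (n * Real.log n))) := by
  rw [L1, ← sum_sub_distrib, mul_sum]
  exact (abs_sum_le_sum_abs _ _).trans <| sum_le_sum fun i _ =>
    abs_eval_selectedPoly_sub_le hc₁ hc₂ hc₃ hn hK (hQ i) (h i)

theorem integral_preEstimator_sub_L1_sq_le (hc₂ : 0 < c₂) (hc : 8 * c₂ ≤ c₁) (hc₃ : 0 ≤ c₃)
    (hn : 1 < n) (hK : 1 ≤ c₂ * Real.log n) (hP : P ∈ stdSimplex ℝ (Fin S))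
    (hQ : ∀ i, 0 ≤ Q i) (h : ∀ i, WellClassified c₁ c₃ n (Q i) (P i) (x i / n)) :
    ∫ y, (preEstimator c₁ c₂ c₃ n Q x y - L1 P Q) ^ 2 ∂poissonSample n P
      ≤ 64 * c₂ * (Real.log n / n ^ (1 - 4 * c₂)) + ((1 + 8 * √(2 * c₁) / c₂)
        * ∑ i, min (Q i) (√(Q i / (n * Real.log n)))) ^ 2 := by
  have hn0 : 0 < n := by linarith
  simp only [preEstimator_eq_sum_unbiased (by linarith : 0 ≤ c₁) hc₃ hn.le]
  rw [poissonSample, integral_sum_sub_sq fun i => memLp_unbiased hn0 (hP.1 i) _]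
  refine add_le_add (sum_variance_unbiased_selectedPoly_le hc₂ hc hc₃ hn hK hP hQ h) ?_
  rw [sum_congr rfl fun i _ => (unbiased_spec hn0 (hP.1 i) _).2]
  exact sq_le_sq.2 ((abs_sum_eval_selectedPoly_sub_L1_le (by linarith) hc₂ hc₃ hn hK hQ h).trans
    (le_abs_self _))

end WellClassifiedSample

theorem risk_le_of_one_le_mul_log (hc₂ : 0 < c₂) (hc : 8 * c₂ ≤ c₁) (hn : 1 < n)
    (hK : 1 ≤ c₂ * Real.log n) (hP : P ∈ stdSimplex ℝ (Fin S)) (hQ : Q ∈ stdSimplex ℝ (Fin S)) :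
    risk c₁ c₂ (c₁ / 4) n Q P ≤ 4 * (S / n ^ (c₁ / 40))
      + (64 * c₂ * (Real.log n / n ^ (1 - 4 * c₂)) + ((1 + 8 * √(2 * c₁) / c₂)
        * ∑ i, min (Q i) (√(Q i / (n * Real.log n)))) ^ 2) := by
  have hc₁ : 0 < c₁ := by linarith
  have hc₃ : 0 ≤ c₁ / 4 := by positivity
  have hlog := Real.log_pos hn
  refine (risk_le_of_forall_wellClassified hP hQ (by positivity)
    (fun x _ => integrable_preEstimator_sub_sq hc₁.le hc₃ hn.le hP Q x _) fun x hx =>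
    integral_preEstimator_sub_L1_sq_le hc₂ hc hc₃ hn hK hP hQ.1 hx).trans ?_
  gcongr
  calc _ ≤ ∑ _i : Fin S, n ^ (-(c₁ / 40)) := sum_le_sum fun i _ =>
        poissonMeasure_real_not_wellClassified_le hc₁ hn (hP.1 i) (Q i)
    _ = S / n ^ (c₁ / 40) := by simp [Real.rpow_neg (by linarith : 0 ≤ n), div_eq_mul_inv]

lemma risk_le_of_mul_log_lt_one (hc₂ : 0 < c₂) (hβ : 0 ≤ β) (hn : 1 < n)
    (hK : c₂ * Real.log n < 1) (hP : P ∈ stdSimplex ℝ (Fin S)) (hQ : Q ∈ stdSimplex ℝ (Fin S)) :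
    risk c₁ c₂ c₃ n Q P ≤ 4 * Real.exp (β / c₂) * (S / n ^ β) := by
  have hn0 : 0 < n := by linarith
  have hS : (1 : ℝ) ≤ S := by
    have : S ≠ 0 := by
      rintro rfl
      simpa using hP.2
    exact_mod_cast Nat.one_le_iff_ne_zero.2 this
  have hnβ : n ^ β ≤ Real.exp (β / c₂) := by
    rw [Real.rpow_def_of_pos hn0, div_eq_inv_mul]
    gcongr
    rw [← one_div, le_div_iff₀' hc₂]
    exact hK.le
  calc risk c₁ c₂ c₃ n Q P ≤ 4 * n ^ β * (1 / n ^ β) := by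
        field_simp
        exact risk_le_four hP hQ
    _ ≤ 4 * Real.exp (β / c₂) * (S / n ^ β) := by gcongr

theorem exists_risk_le {ε : ℝ} (hε : 0 < ε) (hβ : 0 < β) :
    ∃ c₁ c₂ c₃ C : ℝ, 0 < c₃ ∧ c₃ < c₁ ∧ 0 < c₂ ∧ c₂ < c₁ ∧ 0 < C ∧
      ∀ n : ℝ, 1 < n → ∀ (S : ℕ) (Q P : Fin S → ℝ),
        Q ∈ stdSimplex ℝ (Fin S) → P ∈ stdSimplex ℝ (Fin S) →
        risk c₁ c₂ c₃ n Q P ≤ C * ((∑ i, min (Q i) (√(Q i / (n * Real.log n)))) ^ 2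
          + Real.log n / n ^ (1 - ε) + S / n ^ β) := by
  set c₁ := 40 * β with hc₁
  set c₂ := min (5 * β) (ε / 4)
  have hc₂ : 0 < c₂ := by positivity
  have hc₂β : c₂ ≤ 5 * β := min_le_left _ _
  have hc₂ε : c₂ ≤ ε / 4 := min_le_right _ _
  set D := 1 + 8 * √(2 * c₁) / c₂
  set C := 4 * Real.exp (β / c₂) + 64 * c₂ + D ^ 2
  have hexp : 1 ≤ Real.exp (β / c₂) := Real.one_le_exp (by positivity)
  have hC₁ : 4 * Real.exp (β / c₂) ≤ C := by linarith [sq_nonneg D]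
  have hC₂ : 64 * c₂ ≤ C := by linarith [sq_nonneg D]
  have hC₃ : D ^ 2 ≤ C := by linarith
  refine ⟨c₁, c₂, c₁ / 4, C, by positivity, by linarith, hc₂, by linarith, by positivity,
    fun n hn S Q P hQ hP => ?_⟩
  have hlog := Real.log_pos hn
  rcases le_or_gt 1 (c₂ * Real.log n) with hK | hK
  · set A := ∑ i, min (Q i) (√(Q i / (n * Real.log n)))
    calc risk c₁ c₂ (c₁ / 4) n Q P
        ≤ 4 * (S / n ^ (c₁ / 40)) + (64 * c₂ * (Real.log n / n ^ (1 - 4 * c₂)) + (D * A) ^ 2) :=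
          risk_le_of_one_le_mul_log hc₂ (by linarith) hn hK hP hQ
      _ ≤ C * (S / n ^ β) + (C * (Real.log n / n ^ (1 - ε)) + C * A ^ 2) := by
          rw [mul_pow, show c₁ / 40 = β by rw [hc₁]; ring]
          gcongr
          · linarith
          · exact hn.le
          · linarith
      _ = C * (A ^ 2 + Real.log n / n ^ (1 - ε) + S / n ^ β) := by ring
  · refine (risk_le_of_mul_log_lt_one hc₂ hβ.le hn hK hP hQ).trans ?_
    gcongr
    exact le_add_of_nonneg_left (by positivity)

end RiskBounds

/-! ### Comparison of the error terms -/

section ErrorTerms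

variable {n b B : ℝ} {S : ℕ} {Q : Fin S → ℝ}

lemma mul_log_pos (hn : 1 < n) : 0 < n * Real.log n :=
  mul_pos (by linarith) (Real.log_pos hn)

lemma rpow_one_div_le_abs {t : ℝ} (hn : 1 < n) (hb : 0 < b) (h : Real.log n ≤ b * Real.log t) :
    n ^ (1 / b) ≤ |t| := by
  have ht : t ≠ 0 := by
    rintro rfl
    simpa using (Real.log_pos hn).trans_le h
  rw [Real.rpow_def_of_pos (by linarith), mul_one_div, ← Real.exp_log_eq_abs ht]
  gcongr
  exact (div_le_iff₀' hb).2 h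

lemma log_div_rpow_one_sub_le (hn : 1 < n) (hb : 0 < b)
    (h : n ^ (2 / b) ≤ n * Real.log n * B) :
    Real.log n / n ^ (1 - 1 / b) ≤ 4 * b ^ 2 * B := by
  have hn0 : 0 < n := by linarith
  have hlog := Real.log_pos hn
  have hlog_le : Real.log n ≤ 2 * b * n ^ (1 / (2 * b)) := by
    refine (Real.log_le_rpow_div hn0.le (by positivity : 0 < 1 / (2 * b))).trans_eq ?_
    field_simp
  have hsq : (n ^ (1 / (2 * b))) ^ 2 * n ^ (1 / b) = n ^ (2 / b) := by
    rw [← Real.rpow_mul_natCast hn0.le, ← Real.rpow_add hn0]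
    congr 1
    push_cast
    field_simp
    norm_num
  calc Real.log n / n ^ (1 - 1 / b) = Real.log n ^ 2 * n ^ (1 / b) / (n * Real.log n) := by
        rw [Real.rpow_sub hn0, Real.rpow_one]
        field_simp
    _ ≤ (2 * b * n ^ (1 / (2 * b))) ^ 2 * n ^ (1 / b) / (n * Real.log n) := by gcongr
    _ = 4 * b ^ 2 * n ^ (2 / b) / (n * Real.log n) := by
        rw [← hsq]
        ring
    _ ≤ 4 * b ^ 2 * (n * Real.log n * B) / (n * Real.log n) := by gcongr
    _ = 4 * b ^ 2 * B := by field_simp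

lemma inv_le_of_rpow_le (hn : 1 < n) (hb : 0 < b) (h : n ^ (2 / b) ≤ n * Real.log n * B) :
    n⁻¹ ≤ b / 2 * B := by
  have hn0 : 0 < n := by linarith
  have hlog := Real.log_pos hn
  have hlog_le : Real.log n ≤ b / 2 * n ^ (2 / b) := by
    refine (Real.log_le_rpow_div hn0.le (by positivity : 0 < 2 / b)).trans_eq ?_
    field_simp
  calc n⁻¹ = Real.log n / (n * Real.log n) := by field_simp
    _ ≤ b / 2 * (n * Real.log n * B) / (n * Real.log n) := by
        gcongr
        exact hlog_le.trans (by gcongr)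
    _ = b / 2 * B := by field_simp

lemma card_div_rpow_add_one_le {a : ℝ} (hn : 0 < n) (h : Real.log S ≤ a * Real.log n) :
    S / n ^ (a + 1) ≤ n⁻¹ := by
  rw [Real.rpow_add_one hn.ne', div_mul_eq_div_div, ← one_div]
  gcongr
  rw [div_le_one (by positivity)]
  exact Real.le_rpow_of_log_le hn h

lemma sum_min_sqrt_eq_sqrt_mul {t : ℝ} (ht : 0 < t) (Q : Fin S → ℝ) :
    ∑ i, min (√(Q i)) (Q i * √t) = √t * ∑ i, min (Q i) (√(Q i / t)) := by
  rw [mul_sum]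
  refine sum_congr rfl fun i _ => ?_
  rw [mul_min_of_nonneg _ _ (by positivity), Real.sqrt_div' _ ht.le, min_comm, mul_comm (Q i),
    mul_div_cancel₀ _ (by positivity)]

lemma rpow_two_div_le_mul_sq_sum_min (hn : 1 < n) (hb : 0 < b)
    (h : Real.log n ≤ b * Real.log (∑ i, min (√(Q i)) (Q i * √(n * Real.log n)))) :
    n ^ (2 / b) ≤ n * Real.log n * (∑ i, min (Q i) (√(Q i / (n * Real.log n)))) ^ 2 := by
  have hlog := Real.log_pos hn
  rw [sum_min_sqrt_eq_sqrt_mul (by positivity)] at h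
  calc n ^ (2 / b) = (n ^ (1 / b)) ^ 2 := by
        rw [← Real.rpow_mul_natCast (by linarith)]
        ring_nf
    _ ≤ (√(n * Real.log n) * ∑ i, min (Q i) (√(Q i / (n * Real.log n)))) ^ 2 := by
        rw [← sq_abs (_ * _)]
        gcongr
        exact rpow_one_div_le_abs hn hb h
    _ = n * Real.log n * (∑ i, min (Q i) (√(Q i / (n * Real.log n)))) ^ 2 := by
        rw [mul_pow, Real.sq_sqrt (by positivity)]

lemma sq_sum_min_sqrt_le (hQ : Q ∈ stdSimplex ℝ (Fin S)) {t : ℝ} (ht : 0 ≤ t) :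
    (∑ i, min (Q i) (√(Q i / t))) ^ 2 ≤ S / t := by
  calc (∑ i, min (Q i) (√(Q i / t))) ^ 2 ≤ (∑ i, √(Q i / t)) ^ 2 := by
        gcongr with i
        · exact sum_nonneg fun i _ => le_min (hQ.1 i) (Real.sqrt_nonneg _)
        · exact min_le_right _ _
    _ ≤ S * ∑ i, √(Q i / t) ^ 2 := by
        simpa using sq_sum_le_card_mul_sum_sq (s := univ) (f := fun i => √(Q i / t))
    _ = S / t := by
        rw [sum_congr rfl fun i _ => Real.sq_sqrt (div_nonneg (hQ.1 i) ht), ← sum_div, hQ.2,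
          mul_one_div]

lemma rpow_two_div_two_mul_le (hn : 1 < n) (hb : 0 < b) (h : Real.log n ≤ b * Real.log S) :
    n ^ (2 / (2 * b)) ≤ n * Real.log n * (S / (n * Real.log n)) := by
  rw [mul_div_cancel₀ _ (mul_log_pos hn).ne', ← div_div, div_self two_ne_zero]
  simpa using rpow_one_div_le_abs hn hb h

lemma div_rpow_two_le (hn : 1 < n) (S : ℕ) : S / n ^ (2 : ℝ) ≤ S / (n * Real.log n) := by
  have hn0 : 0 < n := by linarith
  rw [Real.rpow_two, sq]
  gcongr
  · exact mul_log_pos hn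
  · exact Real.log_le_self hn0.le

end ErrorTerms

end L1Known

theorem theorem2 :
    (∀ ε β : ℝ, 0 < ε → 0 < β →
      ∃ c₁ c₂ c₃ C : ℝ, 0 < c₃ ∧ c₃ < c₁ ∧ 0 < c₂ ∧ c₂ < c₁ ∧ 0 < C ∧
        ∀ n : ℝ, 1 < n → ∀ (S : ℕ) (Q P : Fin S → ℝ),
          Q ∈ stdSimplex ℝ (Fin S) → P ∈ stdSimplex ℝ (Fin S) →
          L1Known.risk c₁ c₂ c₃ n Q P ≤
            C * ((∑ i, min (Q i) (√(Q i / (n * Real.log n)))) ^ 2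
              + Real.log n / n ^ (1 - ε) + S / n ^ β)) ∧
    (∀ a b : ℝ, 0 < a → 0 < b →
      ∃ c₁ c₂ c₃ C : ℝ, 0 < c₃ ∧ c₃ < c₁ ∧ 0 < c₂ ∧ c₂ < c₁ ∧ 0 < C ∧
        ∀ n : ℝ, 1 < n → ∀ (S : ℕ) (Q P : Fin S → ℝ),
          Q ∈ stdSimplex ℝ (Fin S) → P ∈ stdSimplex ℝ (Fin S) →
          Real.log S ≤ a * Real.log n →
          Real.log n ≤ b * Real.log (∑ i, min (√(Q i)) (Q i * √(n * Real.log n))) →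
          L1Known.risk c₁ c₂ c₃ n Q P ≤
            C * (∑ i, min (Q i) (√(Q i / (n * Real.log n)))) ^ 2) ∧
    (∀ b : ℝ, 0 < b →
      ∃ c₁ c₂ c₃ C : ℝ, 0 < c₃ ∧ c₃ < c₁ ∧ 0 < c₂ ∧ c₂ < c₁ ∧ 0 < C ∧
        ∀ n : ℝ, 1 < n → ∀ (S : ℕ) (Q P : Fin S → ℝ),
          Q ∈ stdSimplex ℝ (Fin S) → P ∈ stdSimplex ℝ (Fin S) →
          Real.log n ≤ b * Real.log S →
          L1Known.risk c₁ c₂ c₃ n Q P ≤ C * (S / (n * Real.log n))) := by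
  refine ⟨fun ε β hε hβ => L1Known.exists_risk_le hε hβ, fun a b ha hb => ?_, fun b hb => ?_⟩
  · obtain ⟨c₁, c₂, c₃, C, hc₃, hc₃₁, hc₂, hc₂₁, hC, hrisk⟩ :=
      L1Known.exists_risk_le (ε := 1 / b) (β := a + 1) (by positivity) (by positivity)
    refine ⟨c₁, c₂, c₃, C * (1 + 4 * b ^ 2 + b / 2), hc₃, hc₃₁, hc₂, hc₂₁, by positivity,
      fun n hn S Q P hQ hP hS hQn => (hrisk n hn S Q P hQ hP).trans ?_⟩
    have hpow := L1Known.rpow_two_div_le_mul_sq_sum_min hn hb hQn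
    have hlog := L1Known.log_div_rpow_one_sub_le hn hb hpow
    have hcard := (L1Known.card_div_rpow_add_one_le (by linarith) hS).trans
      (L1Known.inv_le_of_rpow_le hn hb hpow)
    rw [mul_assoc]
    gcongr
    linarith
  · obtain ⟨c₁, c₂, c₃, C, hc₃, hc₃₁, hc₂, hc₂₁, hC, hrisk⟩ :=
      L1Known.exists_risk_le (ε := 1 / (2 * b)) (β := 2) (by positivity) (by positivity)
    refine ⟨c₁, c₂, c₃, C * (2 + 4 * (2 * b) ^ 2), hc₃, hc₃₁, hc₂, hc₂₁, by positivity,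
      fun n hn S Q P hQ hP hS => (hrisk n hn S Q P hQ hP).trans ?_⟩
    have hbias := L1Known.sq_sum_min_sqrt_le hQ (L1Known.mul_log_pos hn).le
    have hlog := L1Known.log_div_rpow_one_sub_le hn (by positivity : 0 < 2 * b)
      (L1Known.rpow_two_div_two_mul_le hn hb hS)
    have hcard := L1Known.div_rpow_two_le hn S
    rw [mul_assoc]
    gcongr
    linarith
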